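/- Let $n = 2p+1$ with $p \ge 1$. Consider $n$ bodies with masses $m_1,\dots,m_n>0$ on the unit sphere $\mathbb{S}^2=\{x^2+y^2+z^2=1,\ w=0\}\subset\mathbb{R}^4$, with spherical coordinates $(x,y,z)=(\sin\theta\cos\varphi,\sin\theta\sin\varphi,\cos\theta)$, interacting through $U=\sum_{i<j}m_im_j\cot d_{ij}$, where $\cos d_{ij}=\mathbf q_i\cdot\mathbf q_j$. The Hamiltonian is $$H=\sum_{i=1}^n\Big(\frac{p_{\varphi_i}^2}{2m_i\sin^2\theta_i}+\frac{p_{\theta_i}^2}{2m_i}\Big)-U .$$ A configuration of unit vectors with $\mathbf q_i\neq\pm\mathbf q_j$ for $i\ne j$ is an equilibrium configuration if $\sum_{j\ne i} m_im_j(\mathbf q_j-\cos d_{ij}\,\mathbf q_i)/\sin^3 d_{ij}=0$ for all $i$. Let $\mu_k=m_1+\dots+m_k$, and let $\mathcal A$ be the matrix of the Jacobi coordinates $\mathcal A\vec\varphi=(u_2,\dots,u_n,g_n)$, $u_{k+1}=\varphi_{k+1}-\frac1{\mu_k}\sum_{i\le k}m_i\varphi_i$, $g_n=\frac1{\mu_n}\sum_i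 m_i\varphi_i$; the conjugate momenta $(v_2,\dots,v_n,G_n)$ are given by $\vec p_\varphi=\mathcal A^T(v_2,\dots,v_n,G_n)$, so $G_n=J_2:=\sum_i p_{\varphi_i}$. The reduced Hamiltonian system on $J_2^{-1}(c)/SO(2)$, where $SO(2)$ acts by rotations about the $z$-axis, is the canonical Hamiltonian system in the coordinates $(u_2,\dots,u_n,\vec\theta,v_2,\dots,v_n,\vec p_\theta)$ with the Hamiltonian $H_2$ that is obtained from $H$ by putting $G_n=c$ ($H$ does not depend on $g_n$). Let $\bar{\mathbf q}$ be the regular $n$-gon on the equator $\mathbb{S}^1$ (that is, $\varphi_i=2\pi i/n$, $\theta_i=\pi/2$). There is $\varepsilon>0$, depending only on $n$, such that the following holds for all masses $m_1,\dots,m_n>0$ and every equilibrium configuration $\mathbf q=(\varphi_1,\dots,\varphi_n)$ on $\mathbb{S}^1$ for these masses with $|\mathbf q_i-\bar{\mathbf q}_i|<\varepsilon$ for all $i$. For $\alpha\in\mathbb{R}$ let $Y_\alpha$ be the point of $J_2^{-1}(\alpha\sum_i m_i)/SO(2)$ corresponding to the relative equilibrium in which $\mathbf q$ rotates along the equator with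 angular velocity $\alpha$, i.e. the class of $(\varphi_i,\ \theta_i=\frac\pi2,\ p_{\varphi_i}=m_i\alpha,\ p_{\theta_i}=0)$. Then $Y_\alpha$ is an equilibrium of the reduced system for every $\alpha$, and there is a number $\tau>0$ (depending on the masses and on $\mathbf q$, not on $\alpha$) such that $Y_\alpha$ is linearly unstable (the linearization of the reduced system at $Y_\alpha$ has an eigenvalue with positive real part) whenever $\alpha^2<\tau$, and Lyapunov stable whenever $\alpha^2>\tau$. -/

import Mathlib

noncomputable section

namespace CurvedNBody

open scoped Matrix

/-! ### The curved `n`-body problem on the unit sphere of `ℝ⁴` -/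

/-- The ambient space `ℝ⁴` with its Euclidean inner product. -/
abbrev R4 : Type := EuclideanSpace ℝ (Fin 4)

/-- The spherical distance of two unit vectors, `cos (sphDist x y) = x · y`. -/
def sphDist (x y : R4) : ℝ := Real.arccos (inner ℝ x y)

/-- The cotangent potential `U(q) = ∑_{i < j} m_i m_j cot d_{ij}`. -/
def potential {n : ℕ} (m : Fin n → ℝ) (q : Fin n → R4) : ℝ :=
  ∑ i, ∑ j ∈ Finset.Ioi i, m i * m j * Real.cot (sphDist (q i) (q j))

/-- `q` is an equilibrium configuration for the masses `m`: it is a configuration of unit vectors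
outside the singular set (no two of them equal or antipodal), and the gradient of the potential
along the sphere with respect to each particle, that is, the force on each particle, vanishes. -/
def IsEquilibriumConfiguration {n : ℕ} (m : Fin n → ℝ) (q : Fin n → R4) : Prop :=
  (∀ i, ‖q i‖ = 1) ∧
  (∀ i j, i ≠ j → q i ≠ q j ∧ q i ≠ -q j) ∧
  ∀ i, ∑ j ∈ Finset.univ.erase i,
    (m i * m j / Real.sin (sphDist (q i) (q j)) ^ 3) •
      (q j - Real.cos (sphDist (q i) (q j)) • q i) = 0

/-- The point of the two-sphere `{x² + y² + z² = 1, w = 0}` with spherical coordinates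
`(φ, θ)`. -/
def spherePoint (φ θ : ℝ) : R4 :=
  !₂[Real.sin θ * Real.cos φ, Real.sin θ * Real.sin φ, Real.cos θ, 0]

/-- The point of the equator `{x² + y² = 1, z = w = 0}` with longitude `φ`. -/
def equatorPoint (φ : ℝ) : R4 := spherePoint φ (Real.pi / 2)

/-- The regular `n`-gon on the equator, with longitudes `2π/n, 4π/n, …, 2nπ/n`. -/
def regularPolygon (n : ℕ) : Fin n → R4 :=
  fun i => equatorPoint (2 * Real.pi * ((i : ℕ) + 1) / n)

/-- The Hamiltonian of the `n`-body problem on the two-sphere, in spherical coordinates and their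
conjugate momenta. -/
def sphericalHamiltonian {n : ℕ} (m φ θ pφ pθ : Fin n → ℝ) : ℝ :=
  (∑ i, (pφ i ^ 2 / (2 * m i * Real.sin (θ i) ^ 2) + pθ i ^ 2 / (2 * m i)))
    - potential m (fun i => spherePoint (φ i) (θ i))

/-- The first integral of the rotations about the polar axis. -/
def angularMomentum {n : ℕ} (pφ : Fin n → ℝ) : ℝ := ∑ i, pφ i

/-! ### Jacobi coordinates for the longitudes of `k + 1` bodies -/

/-- The mass of the bodies up to and including body number `r`. -/
def partialMass {k : ℕ} (m : Fin (k + 1) → ℝ) (r : Fin (k + 1)) : ℝ := ∑ i ∈ Finset.Iic r, m i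

/-- The matrix of the Jacobi coordinates: the last row gives the centre of mass of all bodies, and
each other row `r` gives the position of body `r + 1` relative to the centre of mass of the bodies
`0, …, r`. -/
def jacobiMatrix {k : ℕ} (m : Fin (k + 1) → ℝ) : Matrix (Fin (k + 1)) (Fin (k + 1)) ℝ :=
  Matrix.of fun r j =>
    if r = Fin.last k then m j / partialMass m (Fin.last k)
    else if j ≤ r then -(m j / partialMass m r)
    else if (j : ℕ) = (r : ℕ) + 1 then 1
    else 0

theorem partialMass_pos {k : ℕ} {m : Fin (k + 1) → ℝ} (hm : ∀ i, 0 < m i) (r : Fin (k + 1)) :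
    0 < partialMass m r :=
  Finset.sum_pos (fun i _ => hm i) ⟨r, Finset.mem_Iic.2 le_rfl⟩

theorem jacobiMatrix_mulVec_last {k : ℕ} (m φ : Fin (k + 1) → ℝ) :
    (jacobiMatrix m *ᵥ φ) (Fin.last k) =
      (∑ j, m j * φ j) / partialMass m (Fin.last k) := by
  simp only [Matrix.mulVec, dotProduct, jacobiMatrix, Matrix.of_apply, if_true, Finset.sum_div]
  exact Finset.sum_congr rfl fun j _ => by ring

theorem jacobiMatrix_mulVec_castSucc {k : ℕ} (m φ : Fin (k + 1) → ℝ) (i : Fin k) :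
    (jacobiMatrix m *ᵥ φ) i.castSucc =
      φ i.succ - (∑ j ∈ Finset.Iic i.castSucc, m j * φ j) / partialMass m i.castSucc := by
  have hi : i.castSucc ≠ Fin.last k := (Fin.castSucc_lt_last i).ne
  have key : ∀ j : Fin (k + 1), jacobiMatrix m i.castSucc j * φ j =
      (if j = i.succ then φ j else 0) -
        (if j ∈ Finset.Iic i.castSucc then m j * φ j / partialMass m i.castSucc else 0) := by
    intro j
    rw [jacobiMatrix, Matrix.of_apply, if_neg hi]
    simp only [Finset.mem_Iic, Fin.ext_iff, Fin.le_def, Fin.val_succ, Fin.val_castSucc]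
    split_ifs <;> first | omega | ring
  simp only [Matrix.mulVec, dotProduct, key, Finset.sum_sub_distrib, Finset.sum_ite_eq',
    Finset.mem_univ, if_true, Finset.sum_ite_mem, Finset.univ_inter, Finset.sum_div]

/-- For positive masses the Jacobi coordinates are indeed coordinates. -/
theorem jacobiMatrix_isUnit_det {k : ℕ} {m : Fin (k + 1) → ℝ} (hm : ∀ i, 0 < m i) :
    IsUnit (jacobiMatrix m).det := by
  rw [← Matrix.isUnit_iff_isUnit_det, ← Matrix.mulVec_injective_iff_isUnit]
  refine (injective_iff_map_eq_zero (Matrix.mulVecLin (jacobiMatrix m))).2 fun x hx => ?_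
  have hx' : ∀ r, (jacobiMatrix m *ᵥ x) r = 0 := fun r => congrFun hx r
  have hconst : ∀ a : ℕ, ∀ h : a < k + 1, x ⟨a, h⟩ = x 0 := by
    intro a
    induction a using Nat.strong_induction_on with
    | _ a ih =>
      intro h
      cases a with
      | zero => rfl
      | succ b =>
        have hb := hx' (Fin.castSucc ⟨b, by omega⟩)
        rw [jacobiMatrix_mulVec_castSucc] at hb
        have hsum : ∑ j ∈ Finset.Iic (Fin.castSucc (⟨b, by omega⟩ : Fin k)), m j * x j =
            partialMass m (Fin.castSucc ⟨b, by omega⟩) * x 0 := by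
          rw [partialMass, Finset.sum_mul]
          refine Finset.sum_congr rfl fun j hj => ?_
          have hjb : (j : ℕ) ≤ b := by simpa [Fin.le_def] using hj
          rw [show x j = x 0 from ih j (by omega) j.2]
        rw [hsum, mul_div_cancel_left₀ _ (partialMass_pos hm _).ne'] at hb
        exact sub_eq_zero.1 hb
  have hl := hx' (Fin.last k)
  rw [jacobiMatrix_mulVec_last] at hl
  have hsum : ∑ j, m j * x j = (∑ j, m j) * x 0 := by
    rw [Finset.sum_mul]
    exact Finset.sum_congr rfl fun j _ => by rw [show x j = x 0 from hconst j j.2]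
  have hpos : 0 < ∑ j, m j := Finset.sum_pos (fun i _ => hm i) Finset.univ_nonempty
  have h0 : x 0 = 0 := by
    rw [hsum] at hl
    rcases div_eq_zero_iff.1 hl with h | h
    · exact (mul_eq_zero.1 h).resolve_left hpos.ne'
    · exact absurd h (partialMass_pos hm _).ne'
  funext j
  exact (hconst j j.2).trans h0

/-! ### The reduced system

For the Jacobi coordinates `(u, g) = 𝒜 φ` of the longitudes and the conjugate momenta `(v, G)`,
which are given by `pφ = 𝒜ᵀ (v, G)`, the momentum `G` is the angular momentum, and rotations about
the polar axis are translations of `g`. So the level set of angular momentum `c`, divided by these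
rotations, has the canonical coordinates `(u, θ, v, pθ)`. -/

/-- Indices of the positions of the reduced system: `u` and `θ`. -/
abbrev ReducedIndex (k : ℕ) : Type := Fin k ⊕ Fin (k + 1)

/-- The reduced phase space in canonical coordinates: positions `(u, θ)`, momenta `(v, pθ)`. -/
abbrev ReducedPhase (k : ℕ) : Type := (ReducedIndex k → ℝ) × (ReducedIndex k → ℝ)

/-- The class, in the reduced phase space, of the state `(φ, θ, pφ, pθ)` on its level set of
angular momentum: apply the Jacobi transformation and drop the last pair `(g, G)`. -/
def reduceState {k : ℕ} (m φ θ pφ pθ : Fin (k + 1) → ℝ) : ReducedPhase k :=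
  (Sum.elim (fun i => (jacobiMatrix m *ᵥ φ) i.castSucc) θ,
   Sum.elim (fun i => ((jacobiMatrix m)ᵀ⁻¹ *ᵥ pφ) i.castSucc) pθ)

/-- The reduced Hamiltonian at angular momentum `c`. The Hamiltonian does not depend on the
coordinate `g`, which is set to `0`. -/
def reducedHamiltonian {k : ℕ} (m : Fin (k + 1) → ℝ) (c : ℝ) (x : ReducedPhase k) : ℝ :=
  sphericalHamiltonian m
    ((jacobiMatrix m)⁻¹ *ᵥ (Fin.snoc (α := fun _ => ℝ) (fun i => x.1 (Sum.inl i)) 0))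
    (fun i => x.1 (Sum.inr i))
    ((jacobiMatrix m)ᵀ *ᵥ (Fin.snoc (α := fun _ => ℝ) (fun i => x.2 (Sum.inl i)) c))
    (fun i => x.2 (Sum.inr i))

theorem potential_rotate {n : ℕ} (m φ θ : Fin n → ℝ) (s : ℝ) :
    potential m (fun i => spherePoint (φ i + s) (θ i)) =
      potential m (fun i => spherePoint (φ i) (θ i)) := by
  have h : ∀ i j, sphDist (spherePoint (φ i + s) (θ i)) (spherePoint (φ j + s) (θ j)) =
      sphDist (spherePoint (φ i) (θ i)) (spherePoint (φ j) (θ j)) := by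
    intro i j
    simp only [sphDist, spherePoint, PiLp.inner_apply, Fin.sum_univ_four]
    congr 1
    simp [Real.cos_add, Real.sin_add]
    linear_combination (Real.sin (θ i) * Real.sin (θ j)) *
      (Real.cos (φ i) * Real.cos (φ j) + Real.sin (φ i) * Real.sin (φ j)) *
        Real.sin_sq_add_cos_sq s
  simp only [potential, h]

theorem jacobiMatrix_mulVec_one {k : ℕ} {m : Fin (k + 1) → ℝ} (hm : ∀ i, 0 < m i) :
    jacobiMatrix m *ᵥ 1 = Pi.single (Fin.last k) 1 := by
  funext r
  induction r using Fin.lastCases with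
  | last =>
    rw [jacobiMatrix_mulVec_last, Pi.single_eq_same]
    simp only [Pi.one_apply, mul_one]
    rw [partialMass, show Finset.Iic (Fin.last k) = Finset.univ from Finset.Iic_top]
    exact div_self (Finset.sum_pos (fun i _ => hm i) Finset.univ_nonempty).ne'
  | cast i =>
    rw [jacobiMatrix_mulVec_castSucc, Pi.single_eq_of_ne (Fin.castSucc_lt_last i).ne]
    simp only [Pi.one_apply, mul_one]
    exact sub_eq_zero.2 (div_self (partialMass_pos hm i.castSucc).ne').symm

/-- The reduced Hamiltonian is the Hamiltonian induced on the reduced phase space: its value at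
the class of a state is the value of the original Hamiltonian at that state. -/
theorem reducedHamiltonian_reduceState {k : ℕ} {m : Fin (k + 1) → ℝ} (hm : ∀ i, 0 < m i)
    (φ θ pφ pθ : Fin (k + 1) → ℝ) :
    reducedHamiltonian m (angularMomentum pφ) (reduceState m φ θ pφ pθ) =
      sphericalHamiltonian m φ θ pφ pθ := by
  have hA := jacobiMatrix_isUnit_det hm
  have hAT : IsUnit (jacobiMatrix m)ᵀ.det := by rwa [Matrix.det_transpose]
  have h1 := jacobiMatrix_mulVec_one hm
  obtain ⟨g, hg⟩ : ∃ g, g = (jacobiMatrix m *ᵥ φ) (Fin.last k) := ⟨_, rfl⟩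
  have hpos : (jacobiMatrix m)⁻¹ *ᵥ (Fin.snoc (α := fun _ => ℝ)
      (fun i => (jacobiMatrix m *ᵥ φ) i.castSucc) 0) = fun i => φ i + -g := by
    have : (Fin.snoc (α := fun _ => ℝ) (fun i => (jacobiMatrix m *ᵥ φ) i.castSucc) 0 :
        Fin (k + 1) → ℝ) = jacobiMatrix m *ᵥ (φ + (-g) • 1) := by
      rw [Matrix.mulVec_add, Matrix.mulVec_smul, h1]
      funext r
      induction r using Fin.lastCases with
      | last => simp [hg]
      | cast i => simp [(Fin.castSucc_lt_last i).ne]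
    rw [this, Matrix.mulVec_mulVec, Matrix.nonsing_inv_mul _ hA, Matrix.one_mulVec]
    funext i
    simp
  have hmom : (jacobiMatrix m)ᵀ *ᵥ (Fin.snoc (α := fun _ => ℝ)
      (fun i => ((jacobiMatrix m)ᵀ⁻¹ *ᵥ pφ) i.castSucc) (angularMomentum pφ)) = pφ := by
    have hw : (jacobiMatrix m)ᵀ *ᵥ ((jacobiMatrix m)ᵀ⁻¹ *ᵥ pφ) = pφ := by
      rw [Matrix.mulVec_mulVec, Matrix.mul_nonsing_inv _ hAT, Matrix.one_mulVec]
    have hlast : angularMomentum pφ = ((jacobiMatrix m)ᵀ⁻¹ *ᵥ pφ) (Fin.last k) := by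
      obtain ⟨w, hw'⟩ : ∃ w, w = (jacobiMatrix m)ᵀ⁻¹ *ᵥ pφ := ⟨_, rfl⟩
      rw [← hw'] at hw ⊢
      have : angularMomentum pφ = (1 : Fin (k + 1) → ℝ) ⬝ᵥ pφ := by
        simp [angularMomentum, dotProduct]
      rw [this, ← hw, Matrix.mulVec_transpose, dotProduct_comm, ← Matrix.dotProduct_mulVec, h1]
      simp
    have : (Fin.snoc (α := fun _ => ℝ) (fun i => ((jacobiMatrix m)ᵀ⁻¹ *ᵥ pφ) i.castSucc)
        (angularMomentum pφ) : Fin (k + 1) → ℝ) = (jacobiMatrix m)ᵀ⁻¹ *ᵥ pφ := by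
      funext r
      induction r using Fin.lastCases with
      | last => simpa using hlast
      | cast i => simp
    rw [this, hw]
  simp only [reducedHamiltonian, reduceState, Sum.elim_inl, Sum.elim_inr]
  rw [hpos, hmom]
  simp only [sphericalHamiltonian, potential_rotate m φ θ (-g)]

/-- The vector field of Hamilton's equations `q' = ∂H/∂p`, `p' = -∂H/∂q`. -/
def hamiltonianVectorField {ι : Type} [Fintype ι] [DecidableEq ι]
    (H : (ι → ℝ) × (ι → ℝ) → ℝ) (x : (ι → ℝ) × (ι → ℝ)) : (ι → ℝ) × (ι → ℝ) :=
  (fun i => fderiv ℝ H x (0, Pi.single i 1), fun i => -fderiv ℝ H x (Pi.single i 1, 0))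

/-- The vector field of the reduced system at angular momentum `c`. -/
def reducedVectorField {k : ℕ} (m : Fin (k + 1) → ℝ) (c : ℝ) : ReducedPhase k → ReducedPhase k :=
  hamiltonianVectorField (reducedHamiltonian m c)

/-- The momenta `p_{φ_i} = m_i α` of a uniform rotation of the equator at angular velocity `α`. -/
def rotationMomenta {n : ℕ} (m : Fin n → ℝ) (α : ℝ) : Fin n → ℝ := fun i => m i * α

/-- The point of the reduced phase space that corresponds to the relative equilibrium in which the
configuration with longitudes `φ` on the equator rotates uniformly at angular velocity `α`:
`θ_i = π/2`, `p_{φ_i} = m_i α`, `p_{θ_i} = 0`. -/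
def reducedEquilibrium {k : ℕ} (m φ : Fin (k + 1) → ℝ) (α : ℝ) : ReducedPhase k :=
  reduceState m φ (fun _ => Real.pi / 2) (rotationMomenta m α) (fun _ => 0)

/-! ### Stability of equilibria -/

section Stability

variable {E : Type*} [NormedAddCommGroup E] [NormedSpace ℝ E]

/-- `x₀` is an equilibrium of `x' = X(x)`. -/
def IsEquilibriumPoint (X : E → E) (x₀ : E) : Prop := X x₀ = 0

/-- Lyapunov stability of `x₀` for `x' = X(x)`: for every `ε > 0` there is a `δ > 0` such that from
each initial value at distance less than `δ` from `x₀` there is a solution for all times `t ≥ 0`,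
and every solution, on whatever interval `[0, T)`, remains at distance less than `ε` from `x₀`. -/
def LyapunovStable (X : E → E) (x₀ : E) : Prop :=
  ∀ ε > 0, ∃ δ > 0, ∀ x, dist x x₀ < δ →
    (∃ γ : ℝ → E, γ 0 = x ∧ IsIntegralCurveOn γ (fun _ => X) (Set.Ici 0)) ∧
    ∀ (γ : ℝ → E) (T : ℝ), γ 0 = x → IsIntegralCurveOn γ (fun _ => X) (Set.Ico 0 T) →
      ∀ t ∈ Set.Ico 0 T, dist (γ t) x₀ < ε

/-- Linear instability of `x₀` for `x' = X(x)`: the linearization at `x₀` exists and (its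
complexification) has an eigenvalue with positive real part. -/
def LinearlyUnstable (X : E → E) (x₀ : E) : Prop :=
  DifferentiableAt ℝ X x₀ ∧
  ∃ μ : ℂ, 0 < μ.re ∧
    Module.End.HasEigenvalue (LinearMap.baseChange ℂ (fderiv ℝ X x₀ : E →ₗ[ℝ] E)) μ

end Stability

end CurvedNBody

end

/-!
Along the family of relative equilibria that rotate on the equator, the quadratic part of the
reduced Hamiltonian at angular velocity `α` splits into the kinetic energy, the Hessian of `-U` in
the longitudes and the form `α² ∑ m_i w_i² - B(w, w)` in the latitudes `w`, where `B` is the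
Hessian of `U` in the latitudes; terms that couple the momenta of the longitudes with the
latitudes are of third order (`sphericalHamiltonian_expansion`, `fderiv_reducedHamiltonian`). Let
`τ` be the largest eigenvalue of `B` relative to `∑ m_i w_i²` (`exists_max_eigenvalue`); it is
positive because `B` is positive at `w = (1, …, 1)` (`latitudeForm_one_pos`).

If `α² < τ` and `w` is an eigenvector for `τ`, then the linearized system has the eigenvalue `μ =
√(τ - α²)` with the eigenvector `(w, m μ w)` in the latitudes and their momenta
(`linearlyUnstable_reducedVectorField`).

If `α² > τ`, the part in the latitudes is positive definite. The part in the longitudes is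
positive definite modulo rotations, which the reduction has removed: this is the only point where
the configuration has to be close to the regular polygon (`exists_hessian_pos_near_regular`). So
the reduced Hamiltonian has a nondegenerate minimum, and the energy criterion of Lagrange and
Dirichlet applies (`lyapunovStable_hamiltonianVectorField`).

Closeness to the regular polygon is used as follows. The condition that a configuration on the
equator is an equilibrium is linear in the masses. At the regular polygon its matrix is circulant,
and for an odd number of vertices its kernel consists of the equal masses
(`eq_of_regular_force_eq_zero`); for equal masses the Hessian in the longitudes is circulant as
well, with positive eigenvalues except for the one of the rotations (`regular_hessian_pos`). Both
facts are statements about finite trigonometric sums, which are shown to be concave, or to have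
concave increments, in the frequency. By compactness of the normalized masses and displacements,
the positivity of the Hessian persists at all nearby equilibria, whatever their masses are.
-/

/-! ### Lyapunov functions and the energy criterion for Hamiltonian systems -/

namespace CurvedNBody

open Set Metric Filter Topology

section Dynamics

variable {E : Type*} [NormedAddCommGroup E] [NormedSpace ℝ E]

/-- A bounded Lipschitz vector field is complete in forward time: Picard–Lindelöf gives a solution
on each `[0, N]`, and by uniqueness these fit together. -/
theorem exists_isIntegralCurveOn_Ici [CompleteSpace E] {X : E → E} {K : NNReal}
    (hX : LipschitzWith K X) {L : NNReal} (hL : ∀ x, ‖X x‖ ≤ L) (x : E) :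
    ∃ γ : ℝ → E, γ 0 = x ∧ IsIntegralCurveOn γ (fun _ => X) (Ici 0) := by
  have hN : ∀ N : ℕ, ∃ γ : ℝ → E, γ 0 = x ∧
      ∀ t ∈ Icc (0 : ℝ) N, HasDerivWithinAt γ (X (γ t)) (Icc (0 : ℝ) N) t := by
    intro N
    have h0 : (0 : ℝ) ∈ Icc (0 : ℝ) N := ⟨le_rfl, N.cast_nonneg⟩
    have hP : IsPicardLindelof (fun _ => X) (⟨0, h0⟩ : Icc (0 : ℝ) N) x (L * N) 0 L K := by
      refine IsPicardLindelof.of_time_independent (fun y _ => hL y) hX.lipschitzOnWith ?_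
      simp
    exact hP.exists_eq_forall_mem_Icc_hasDerivWithinAt₀
  choose γ h0 hγ using hN
  have hderiv : ∀ N : ℕ, ∀ t ∈ Ico (0 : ℝ) N, HasDerivWithinAt (γ N) (X (γ N t)) (Ici t) t := by
    intro N t ht
    have := (hγ N t ⟨ht.1, ht.2.le⟩).mono (Icc_subset_Icc_left ht.1)
    exact this.mono_of_mem_nhdsWithin (Icc_mem_nhdsGE ht.2)
  have hcont : ∀ N : ℕ, ContinuousOn (γ N) (Icc (0 : ℝ) N) := fun N t ht =>
    (hγ N t ht).continuousWithinAt
  have huniq : ∀ N M : ℕ, N ≤ M → ∀ t ∈ Icc (0 : ℝ) N, γ N t = γ M t := by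
    intro N M hNM
    have hNM' : (N : ℝ) ≤ M := by exact_mod_cast hNM
    exact ODE_solution_unique (v := fun _ => X) (fun _ => hX) (hcont N) (hderiv N)
      ((hcont M).mono (Icc_subset_Icc_right hNM'))
      (fun t ht => hderiv M t ⟨ht.1, ht.2.trans_le hNM'⟩) ((h0 N).trans (h0 M).symm)
  have hglue : ∀ N : ℕ, ∀ t ∈ Icc (0 : ℝ) N, γ ⌈t⌉₊ t = γ N t := fun N t ht =>
    huniq _ _ (Nat.ceil_le.2 ht.2) t ⟨ht.1, Nat.le_ceil t⟩
  refine ⟨fun t => γ ⌈t⌉₊ t, by simp [h0], fun t ht => ?_⟩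
  have ht0 : (0 : ℝ) ≤ t := ht
  obtain ⟨N, hNt⟩ := exists_nat_gt t
  have h1 : HasDerivWithinAt (fun t => γ ⌈t⌉₊ t) (X (γ N t)) (Icc (0 : ℝ) N) t :=
    (hγ N t ⟨ht0, hNt.le⟩).congr (fun s hs => hglue N s hs) (hglue N t ⟨ht0, hNt.le⟩)
  rw [← hglue N t ⟨ht0, hNt.le⟩] at h1
  refine h1.mono_of_mem_nhdsWithin ?_
  rw [← Ici_inter_Iic]
  exact inter_mem_nhdsWithin _ (Iic_mem_nhds hNt)

/-- A continuous curve starting strictly below the values of `H` on the sphere of radius `r`, along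
which `H` is conserved as long as it stays in the ball of radius `r`, never leaves that ball. -/
theorem dist_lt_of_conserved {X : E → E} {H : E → ℝ} {x₀ : E} {r : ℝ}
    (hH : ∀ x ∈ closedBall x₀ r, DifferentiableAt ℝ H x)
    (hX : ∀ x ∈ closedBall x₀ r, fderiv ℝ H x (X x) = 0)
    {γ : ℝ → E} {T : ℝ} (hγ : IsIntegralCurveOn γ (fun _ => X) (Ico 0 T))
    (h0 : dist (γ 0) x₀ < r) (hlow : ∀ x, dist x x₀ = r → H (γ 0) < H x) :
    ∀ t ∈ Ico 0 T, dist (γ t) x₀ < r := by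
  intro t ht
  by_contra! hcon
  have hsub : Icc 0 t ⊆ Ico 0 T := fun s hs => ⟨hs.1, hs.2.trans_lt ht.2⟩
  have hc : ContinuousOn (fun s => dist (γ s) x₀) (Icc 0 t) := fun s hs =>
    ((hγ s (hsub hs)).continuousWithinAt.mono hsub).dist continuousWithinAt_const
  -- the first time at which the curve reaches the sphere
  let S : Set ℝ := Icc 0 t ∩ (fun s => dist (γ s) x₀) ⁻¹' {r}
  have hScl : IsClosed S := hc.preimage_isClosed_of_isClosed isClosed_Icc isClosed_singleton
  have hSne : S.Nonempty := by
    obtain ⟨s, hs, hs'⟩ := intermediate_value_Icc ht.1 hc ⟨h0.le, hcon⟩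
    exact ⟨s, hs, hs'⟩
  have hSbd : BddBelow S := ⟨0, fun s hs => hs.1.1⟩
  obtain ⟨hs, hsr⟩ := hScl.csInf_mem hSne hSbd
  set s := sInf S with hsdef
  have hbefore : ∀ u ∈ Icc 0 s, dist (γ u) x₀ ≤ r := by
    intro u hu
    by_contra! hur
    have hut : u ≤ t := hu.2.trans hs.2
    obtain ⟨v, hv, hv'⟩ := intermediate_value_Icc hu.1 (hc.mono (Icc_subset_Icc_right hut))
      ⟨h0.le, hur.le⟩
    have hvS : v ∈ S := ⟨⟨hv.1, hv.2.trans hut⟩, hv'⟩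
    have h1 : s ≤ v := csInf_le hSbd hvS
    have h2 : v = u := le_antisymm hv.2 (hu.2.trans h1)
    rw [h2] at hv'
    exact absurd hv' hur.ne'
  have hHc : ∀ u ∈ Icc 0 s, HasDerivWithinAt (H ∘ γ) 0 (Icc 0 s) u := by
    intro u hu
    have hb : γ u ∈ closedBall x₀ r := hbefore u hu
    have h1 := (hγ u ⟨hu.1, (hu.2.trans hs.2).trans_lt ht.2⟩).mono
      (show Icc 0 s ⊆ Ico 0 T from fun v hv => ⟨hv.1, (hv.2.trans hs.2).trans_lt ht.2⟩)
    have h2 := (hH _ hb).hasFDerivAt.comp_hasDerivWithinAt u h1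
    rwa [hX _ hb] at h2
  have hconst := constant_of_has_deriv_right_zero (fun u hu => (hHc u hu).continuousWithinAt)
    (fun u hu => (((hHc u ⟨hu.1, hu.2.le⟩).mono (Icc_subset_Icc_left hu.1)).mono_of_mem_nhdsWithin
      (Icc_mem_nhdsGE hu.2))) s ⟨hs.1, le_rfl⟩
  have := hlow (γ s) hsr
  simp only [Function.comp_apply] at hconst
  linarith

/-- A strict local minimum of a conserved quantity is Lyapunov stable. Solutions exist for all times
because the vector field, multiplied by a bump function, becomes complete without being changed on
the ball that the solutions do not leave. -/
theorem lyapunovStable_of_conserved [FiniteDimensional ℝ E] {X : E → E} {H : E → ℝ} {x₀ : E} {c : ℝ}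
    (hc : 0 < c) (hX : ContDiffAt ℝ 1 X x₀) (hH : ContDiffAt ℝ 1 H x₀)
    (hcons : ∀ x, fderiv ℝ H x (X x) = 0)
    (hmin : ∀ᶠ x in 𝓝 x₀, H x₀ + c * ‖x - x₀‖ ^ 2 ≤ H x) : LyapunovStable X x₀ := by
  intro ε hε
  obtain ⟨R, hR, hR'⟩ := Metric.eventually_nhds_iff_ball.1
    (((hX.eventually (by simp)).and (hH.eventually (by simp))).and hmin)
  obtain ⟨r, hr, hrε, hrR⟩ : ∃ r, 0 < r ∧ r ≤ ε ∧ r < R :=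
    ⟨min ε (R / 2), lt_min hε (half_pos hR), min_le_left _ _,
      (min_le_right _ _).trans_lt (half_lt_self hR)⟩
  have hball : closedBall x₀ r ⊆ ball x₀ R := closedBall_subset_ball hrR
  have hdiff : ∀ x ∈ closedBall x₀ r, DifferentiableAt ℝ H x := fun x hx =>
    (hR' x (hball hx)).1.2.differentiableAt (by simp)
  have hev : ∀ᶠ x in 𝓝 x₀, H x < H x₀ + c * r ^ 2 :=
    hH.continuousAt.eventually_lt_const (by simp; positivity)
  obtain ⟨δ, hδ, hδ'⟩ := Metric.eventually_nhds_iff_ball.1 hev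
  have hlow : ∀ y ∈ ball x₀ δ, ∀ x, dist x x₀ = r → H y < H x := by
    intro y hy x hx
    have h1 := (hR' x (hball hx.le)).2
    rw [← dist_eq_norm, hx] at h1
    exact (hδ' y hy).trans_le h1
  obtain ⟨χ, hχin, hχout⟩ : ∃ χ : ContDiffBump x₀, χ.rIn = r ∧ χ.rOut < R :=
    ⟨⟨r, R / 2 + r / 2, hr, by linarith⟩, rfl, by change R / 2 + r / 2 < R; linarith⟩
  have hχc : ContDiff ℝ 1 (fun x => χ x • X x) := by
    rw [contDiff_iff_contDiffAt]
    intro x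
    by_cases hx : x ∈ tsupport χ
    · rw [χ.tsupport_eq] at hx
      exact χ.contDiffAt.smul (hR' x (closedBall_subset_ball hχout hx)).1.1
    · have h0 := notMem_tsupport_iff_eventuallyEq.1 hx
      refine contDiffAt_const (c := (0 : E)) |>.congr_of_eventuallyEq ?_
      filter_upwards [h0] with y hy
      simp [hy]
  have hχs : HasCompactSupport (fun x => χ x • X x) := χ.hasCompactSupport.smul_right
  obtain ⟨K, hK⟩ := ContDiff.lipschitzWith_of_hasCompactSupport (𝕂 := ℝ) hχs hχc one_ne_zero
  obtain ⟨B, hB⟩ := hχs.exists_bound_of_continuous hχc.continuous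
  have hBn : ∀ x, ‖χ x • X x‖ ≤ (B.toNNReal : ℝ) := fun x => (hB x).trans (Real.le_coe_toNNReal B)
  have : CompleteSpace E := FiniteDimensional.complete ℝ E
  refine ⟨min δ r, lt_min hδ hr, fun x hx => ⟨?_, ?_⟩⟩
  · obtain ⟨γ, hγ0, hγ⟩ := exists_isIntegralCurveOn_Ici hK hBn x
    refine ⟨γ, hγ0, fun t ht => ?_⟩
    have ht0 : (0 : ℝ) ≤ t := ht
    have hstay : dist (γ t) x₀ < r := by
      refine dist_lt_of_conserved (X := fun x => χ x • X x) (T := t + 1) hdiff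
        (fun y _ => by simp [hcons]) (hγ.mono fun s hs => hs.1)
        (by rw [hγ0]; exact hx.trans_le (min_le_right _ _)) ?_ t ⟨ht0, by linarith⟩
      rw [hγ0]
      exact hlow x (hx.trans_le (min_le_left _ _))
    have h1 : χ (γ t) = 1 := χ.one_of_mem_closedBall (by rw [hχin]; exact hstay.le)
    have h2 := hγ t ht
    simpa only [h1, one_smul] using h2
  · intro γ T hγ0 hγ t ht
    refine (dist_lt_of_conserved hdiff (fun y _ => hcons y) hγ
      (by rw [hγ0]; exact hx.trans_le (min_le_right _ _)) ?_ t ht).trans_le hrε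
    rw [hγ0]
    exact hlow x (hx.trans_le (min_le_left _ _))

/-- The second derivative test: near a critical point with positive definite Hessian a function
grows at least quadratically. -/
theorem exists_quadratic_growth [FiniteDimensional ℝ E] {H : E → ℝ} {x₀ : E}
    (hH : ContDiffAt ℝ 2 H x₀) (h1 : fderiv ℝ H x₀ = 0)
    (h2 : ∀ u, u ≠ 0 → 0 < fderiv ℝ (fderiv ℝ H) x₀ u u) :
    ∃ c > 0, ∀ᶠ x in 𝓝 x₀, H x₀ + c * ‖x - x₀‖ ^ 2 ≤ H x := by
  obtain ⟨c, hc, hQ⟩ : ∃ c > 0, ∀ u, c * ‖u‖ ^ 2 ≤ fderiv ℝ (fderiv ℝ H) x₀ u u := by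
    have : ProperSpace E := FiniteDimensional.proper_real E
    rcases (sphere (0 : E) 1).eq_empty_or_nonempty with he | hne
    · refine ⟨1, one_pos, fun u => ?_⟩
      by_cases hu : u = 0
      · simp [hu]
      · have : ‖u‖⁻¹ • u ∈ sphere (0 : E) 1 := by
          simp [norm_smul, inv_mul_cancel₀ (norm_ne_zero_iff.2 hu)]
        rw [he] at this
        exact this.elim
    · obtain ⟨v, hv, hmin⟩ := (isCompact_sphere (0 : E) 1).exists_isMinOn hne
        (f := fun u => fderiv ℝ (fderiv ℝ H) x₀ u u) (by fun_prop)
      have hv0 : v ≠ 0 := by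
        rintro rfl
        simp at hv
      refine ⟨_, h2 v hv0, fun u => ?_⟩
      by_cases hu : u = 0
      · simp [hu]
      · have hu' := norm_ne_zero_iff.2 hu
        have hmem : ‖u‖⁻¹ • u ∈ sphere (0 : E) 1 := by
          simp [norm_smul, inv_mul_cancel₀ hu']
        have := isMinOn_iff.1 hmin _ hmem
        simp only [map_smul, smul_apply, smul_eq_mul] at this
        calc _ ≤ (‖u‖⁻¹ * (‖u‖⁻¹ * fderiv ℝ (fderiv ℝ H) x₀ u u)) * ‖u‖ ^ 2 := by gcongr
          _ = _ := by field_simp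
  have hd : HasFDerivAt (fderiv ℝ H) (fderiv ℝ (fderiv ℝ H) x₀) x₀ :=
    ((hH.fderiv_right (m := 1) (by norm_num)).differentiableAt (by simp)).hasFDerivAt
  have ho := hd.isLittleO.def (half_pos hc)
  obtain ⟨R, hR, hR'⟩ := Metric.eventually_nhds_iff_ball.1
    (ho.and (hH.eventually (by simp)))
  refine ⟨c / 4, by positivity, Metric.eventually_nhds_iff_ball.2 ⟨R, hR, fun x hx => ?_⟩⟩
  obtain ⟨u, rfl⟩ : ∃ u, x = x₀ + u := ⟨x - x₀, by simp⟩
  rw [mem_ball, dist_eq_norm, add_sub_cancel_left] at hx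
  rw [add_sub_cancel_left]
  have hseg : ∀ t ∈ Icc (0 : ℝ) 1, x₀ + t • u ∈ ball x₀ R := by
    intro t ht
    rw [mem_ball, dist_eq_norm, add_sub_cancel_left, norm_smul, Real.norm_of_nonneg ht.1]
    nlinarith [norm_nonneg u, ht.2]
  -- on `[0, 1]` the function `t ↦ H (x₀ + t u) - (c / 4) ‖u‖² t²` has a nonnegative derivative
  have hder : ∀ t ∈ Icc (0 : ℝ) 1,
      HasDerivAt (fun t : ℝ => H (x₀ + t • u) - c / 4 * ‖u‖ ^ 2 * t ^ 2)
      (fderiv ℝ H (x₀ + t • u) u - c / 4 * ‖u‖ ^ 2 * (2 * t)) t := by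
    intro t ht
    have h3 : HasDerivAt (fun t : ℝ => x₀ + t • u) u t := by
      simpa using ((hasDerivAt_id t).smul_const u).const_add x₀
    have h4 := (((hR' _ (hseg t ht)).2.differentiableAt (by simp)).hasFDerivAt).comp_hasDerivAt t h3
    have h5 : HasDerivAt (fun t : ℝ => t ^ 2) (2 * t) t := by simpa using hasDerivAt_pow 2 t
    exact h4.sub (h5.const_mul _)
  have hpos : ∀ t ∈ Ioo (0 : ℝ) 1, 0 ≤ fderiv ℝ H (x₀ + t • u) u - c / 4 * ‖u‖ ^ 2 * (2 * t) := by
    intro t ht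
    have h3 := (hR' _ (hseg t ⟨ht.1.le, ht.2.le⟩)).1
    rw [h1, sub_zero, add_sub_cancel_left] at h3
    have h4 := (ContinuousLinearMap.le_opNorm (fderiv ℝ H (x₀ + t • u) -
      fderiv ℝ (fderiv ℝ H) x₀ (t • u)) u).trans (mul_le_mul_of_nonneg_right h3 (norm_nonneg u))
    rw [norm_smul, Real.norm_of_nonneg ht.1.le] at h4
    simp only [map_smul, sub_apply, smul_apply,
      smul_eq_mul, Real.norm_eq_abs] at h4
    have h5 := abs_le.1 h4
    have h6 := mul_le_mul_of_nonneg_left (hQ u) ht.1.le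
    nlinarith [h5.1]
  have hmono := monotoneOn_of_deriv_nonneg (convex_Icc (0 : ℝ) 1)
    (fun t ht => (hder t ht).continuousAt.continuousWithinAt)
    (fun t ht => (hder t (interior_subset ht)).differentiableAt.differentiableWithinAt)
    (fun t ht => by
      rw [interior_Icc] at ht
      rw [(hder t ⟨ht.1.le, ht.2.le⟩).deriv]
      exact hpos t ht)
  have := hmono ⟨le_rfl, zero_le_one⟩ ⟨zero_le_one, le_rfl⟩ zero_le_one
  simp at this
  linarith

theorem fderiv_apply_eq_of_line {H : E → ℝ} {x₀ u : E} {d : ℝ} (hH : DifferentiableAt ℝ H x₀)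
    (h : HasDerivAt (fun t : ℝ => H (x₀ + t • u)) d 0) : fderiv ℝ H x₀ u = d :=
  (hH.hasFDerivAt.hasLineDerivAt u).unique h

/-- The Hessian is the second derivative along lines. The first derivatives `h'` along the line are
supplied separately, so that only explicit functions of one variable have to be differentiated. -/
theorem fderiv_fderiv_apply_eq_of_line {H : E → ℝ} {x₀ u : E} {h' : ℝ → ℝ} {d : ℝ}
    (hH : ContDiffAt ℝ 2 H x₀)
    (h1 : ∀ᶠ t in 𝓝 (0 : ℝ), HasDerivAt (fun t : ℝ => H (x₀ + t • u)) (h' t) t)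
    (h2 : HasDerivAt h' d 0) : fderiv ℝ (fderiv ℝ H) x₀ u u = d := by
  have hline : ∀ t : ℝ, HasDerivAt (fun t : ℝ => x₀ + t • u) u t := fun t => by
    simpa using ((hasDerivAt_id t).smul_const u).const_add x₀
  have hx : x₀ + (0 : ℝ) • u = x₀ := by simp
  have hcont : Tendsto (fun t : ℝ => x₀ + t • u) (𝓝 0) (𝓝 x₀) := by
    simpa using (hline 0).continuousAt.tendsto
  have hev : h' =ᶠ[𝓝 0] fun t => fderiv ℝ H (x₀ + t • u) u := by
    filter_upwards [h1, hcont.eventually (hH.eventually (by simp))] with t ht hd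
    exact ht.unique ((hd.differentiableAt (by simp)).hasFDerivAt.comp_hasDerivAt t (hline t))
  have hd : HasFDerivAt (fderiv ℝ H) (fderiv ℝ (fderiv ℝ H) x₀) x₀ :=
    ((hH.fderiv_right (m := 1) (by norm_num)).differentiableAt (by simp)).hasFDerivAt
  have hu : HasFDerivAt (fun y => fderiv ℝ H y u) ((fderiv ℝ (fderiv ℝ H) x₀).flip u) x₀ := by
    simpa using hd.clm_apply (hasFDerivAt_const u x₀)
  have h3 : HasDerivAt (fun t : ℝ => fderiv ℝ H (x₀ + t • u) u)
      ((fderiv ℝ (fderiv ℝ H) x₀).flip u u) 0 := by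
    exact HasFDerivAt.comp_hasDerivAt_of_eq 0 hu (hline 0) hx.symm
  exact h3.unique (h2.congr_of_eventuallyEq hev.symm)

end Dynamics

section Hamiltonian

variable {ι : Type} [Fintype ι] [DecidableEq ι] {H : (ι → ℝ) × (ι → ℝ) → ℝ}
  {x : (ι → ℝ) × (ι → ℝ)}

/-- Conservation of energy. -/
theorem fderiv_hamiltonianVectorField (x : (ι → ℝ) × (ι → ℝ)) :
    fderiv ℝ H x (hamiltonianVectorField H x) = 0 := by
  set D := fderiv ℝ H x with hD
  have key : ∀ a b : ι → ℝ, D (a, b) =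
      ∑ i, (a i * D (Pi.single i 1, 0) + b i * D (0, Pi.single i 1)) := by
    intro a b
    have : ((a, b) : (ι → ℝ) × (ι → ℝ)) =
        ∑ i, (a i • ((Pi.single i 1, 0) : (ι → ℝ) × (ι → ℝ)) + b i • (0, Pi.single i 1)) := by
      ext j
      · simp [Prod.fst_sum, Finset.sum_apply, Pi.single_apply]
      · simp [Prod.snd_sum, Finset.sum_apply, Pi.single_apply]
    rw [this, map_sum]
    exact Finset.sum_congr rfl fun i _ => by rw [map_add, map_smul, map_smul]; rfl
  rw [hamiltonianVectorField, key, ← hD]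
  exact Finset.sum_eq_zero fun i _ => by ring

theorem contDiffAt_hamiltonianVectorField (hH : ContDiffAt ℝ 2 H x) :
    ContDiffAt ℝ 1 (hamiltonianVectorField H) x := by
  have h1 : ContDiffAt ℝ 1 (fderiv ℝ H) x := hH.fderiv_right (by norm_num)
  unfold hamiltonianVectorField
  refine ContDiffAt.prodMk ?_ ?_
  · exact contDiffAt_pi.2 fun i => h1.clm_apply contDiffAt_const
  · exact contDiffAt_pi.2 fun i => (h1.clm_apply contDiffAt_const).neg

theorem fderiv_hamiltonianVectorField_apply (hH : ContDiffAt ℝ 2 H x) (v : (ι → ℝ) × (ι → ℝ)) :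
    fderiv ℝ (hamiltonianVectorField H) x v =
      (fun i => fderiv ℝ (fderiv ℝ H) x v (0, Pi.single i 1),
        fun i => -fderiv ℝ (fderiv ℝ H) x v (Pi.single i 1, 0)) := by
  have hd : HasFDerivAt (fderiv ℝ H) (fderiv ℝ (fderiv ℝ H) x) x :=
    ((hH.fderiv_right (m := 1) (by norm_num)).differentiableAt (by simp)).hasFDerivAt
  have hv : ∀ w, HasFDerivAt (fun y => fderiv ℝ H y w)
      ((fderiv ℝ (fderiv ℝ H) x).flip w) x := fun w => by
    simpa using hd.clm_apply (hasFDerivAt_const w x)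
  have h : HasFDerivAt (hamiltonianVectorField H)
      ((ContinuousLinearMap.pi fun i => (fderiv ℝ (fderiv ℝ H) x).flip (0, Pi.single i 1)).prod
        (ContinuousLinearMap.pi fun i => -(fderiv ℝ (fderiv ℝ H) x).flip (Pi.single i 1, 0))) x :=
    (hasFDerivAt_pi.2 fun i => hv _).prodMk (hasFDerivAt_pi.2 fun i => (hv _).neg)
  rw [h.fderiv]
  rfl

/-- The energy criterion of Lagrange and Dirichlet: an equilibrium at which the Hamiltonian has a
positive definite Hessian is Lyapunov stable. -/
theorem lyapunovStable_hamiltonianVectorField (hH : ContDiffAt ℝ 2 H x) (h1 : fderiv ℝ H x = 0)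
    (h2 : ∀ u, u ≠ 0 → 0 < fderiv ℝ (fderiv ℝ H) x u u) :
    LyapunovStable (hamiltonianVectorField H) x := by
  obtain ⟨c, hc, hmin⟩ := exists_quadratic_growth hH h1 h2
  exact lyapunovStable_of_conserved hc (contDiffAt_hamiltonianVectorField hH)
    (hH.of_le (by norm_num)) fderiv_hamiltonianVectorField hmin

theorem linearlyUnstable_of_apply_eq_smul {E : Type*} [NormedAddCommGroup E] [NormedSpace ℝ E]
    {X : E → E} {x₀ v : E} {μ : ℝ} (hX : DifferentiableAt ℝ X x₀) (hμ : 0 < μ) (hv : v ≠ 0)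
    (h : fderiv ℝ X x₀ v = μ • v) : LinearlyUnstable X x₀ := by
  refine ⟨hX, μ, by simpa using hμ, ?_⟩
  refine Module.End.hasEigenvalue_of_hasEigenvector (x := (1 : ℂ) ⊗ₜ[ℝ] v) ⟨?_, ?_⟩
  · rw [Module.End.mem_eigenspace_iff, LinearMap.baseChange_tmul]
    change (1 : ℂ) ⊗ₜ[ℝ] (fderiv ℝ X x₀ v) = _
    rw [h, TensorProduct.tmul_smul, TensorProduct.smul_tmul', TensorProduct.smul_tmul']
    simp
  · intro h0
    exact hv ((Module.FaithfullyFlat.one_tmul_eq_zero_iff ℝ E v).1 h0)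

end Hamiltonian

end CurvedNBody

/-! ### Trigonometric sums over the angles of the regular polygon -/

namespace CurvedNBody

open Finset Real

/-- A sequence that is concave on `{0, …, p}` and nonnegative at `0` lies above the segment from the
origin to `(p, f p)`. -/
theorem mul_le_mul_of_concave {f : ℕ → ℝ} {p : ℕ} (h0 : 0 ≤ f 0)
    (hf : ∀ r, 1 ≤ r → r < p → f (r + 1) + f (r - 1) ≤ 2 * f r) {r : ℕ} (hr : r ≤ p) :
    (r : ℝ) * f p ≤ p * f r := by
  -- `f r / r` decreases
  have hdec : ∀ r, r < p → (r : ℝ) * f (r + 1) ≤ (r + 1) * f r := by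
    intro r
    induction r with
    | zero => intro _; simpa using h0
    | succ s ih =>
      intro hs
      have h1 := ih (by omega)
      have h2 := hf (s + 1) (by omega) hs
      simp only [Nat.add_sub_cancel] at h2
      push_cast
      have h3 := mul_le_mul_of_nonneg_left h2 (show (0 : ℝ) ≤ s + 1 by positivity)
      linarith
  induction hr using Nat.decreasingInduction with
  | self => exact le_rfl
  | of_succ s hs ih =>
    have h1 := hdec s (by omega)
    push_cast at ih
    have h2 := mul_le_mul_of_nonneg_left ih (show (0 : ℝ) ≤ s by positivity)
    have h3 := mul_le_mul_of_nonneg_left h1 (show (0 : ℝ) ≤ p by positivity)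
    have h4 : (0 : ℝ) < s + 1 := by positivity
    refine le_of_mul_le_mul_left ?_ h4
    linarith

section Trigonometric

variable (p : ℕ)

/-- The angle `2πd/n` for `n = 2p + 1`, written `t_d` in the comments. -/
noncomputable def polygonAngle (d : ℕ) : ℝ := 2 * π * d / (2 * p + 1)

variable {p}

theorem polygonAngle_mem {d : ℕ} (hd : d ∈ Icc 1 p) :
    0 < polygonAngle p d ∧ polygonAngle p d < π := by
  obtain ⟨h1, h2⟩ := Finset.mem_Icc.1 hd
  have h1' : (1 : ℝ) ≤ d := by exact_mod_cast h1
  have h2' : (d : ℝ) ≤ p := by exact_mod_cast h2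
  have hp : (0 : ℝ) < 2 * p + 1 := by positivity
  unfold polygonAngle
  constructor
  · have := pi_pos; positivity
  · rw [div_lt_iff₀ hp]
    nlinarith [pi_pos]

theorem sin_polygonAngle_pos {d : ℕ} (hd : d ∈ Icc 1 p) : 0 < sin (polygonAngle p d) :=
  sin_pos_of_pos_of_lt_pi (polygonAngle_mem hd).1 (polygonAngle_mem hd).2

theorem polygonAngle_mul_comm (d r : ℕ) : r * polygonAngle p d = d * polygonAngle p r := by
  unfold polygonAngle
  ring

theorem mul_polygonAngle (d : ℕ) : (2 * p + 1) * polygonAngle p d = d * (2 * π) := by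
  have hp : (0 : ℝ) < 2 * p + 1 := by positivity
  unfold polygonAngle
  field_simp

/-- `∑ sin (2 r t_d) ≤ 0`, where the sum telescopes after multiplication by `sin t_r`. -/
theorem sum_sin_nonpos {r : ℕ} (hr : r ≤ p) :
    ∑ d ∈ Icc 1 p, sin (2 * r * polygonAngle p d) ≤ 0 := by
  rcases Nat.eq_zero_or_pos r with rfl | hr0
  · simp
  have hs := sin_polygonAngle_pos (p := p) (d := r) (Finset.mem_Icc.2 ⟨hr0, hr⟩)
  set y := polygonAngle p r with hy
  have htel : ∀ q : ℕ, 2 * sin y * ∑ d ∈ Icc 1 q, sin (2 * r * polygonAngle p d) =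
      cos y - cos ((2 * q + 1) * y) := by
    intro q
    induction q with
    | zero => simp
    | succ q ih =>
      rw [Finset.sum_Icc_succ_top (by omega), mul_add, ih, mul_assoc 2 (r : ℝ),
        polygonAngle_mul_comm, ← hy]
      have h1 : (2 * (q : ℝ) + 1) * y = 2 * ((q + 1 : ℕ) * y) - y := by push_cast; ring
      have h2 : (2 * ((q + 1 : ℕ) : ℝ) + 1) * y = 2 * ((q + 1 : ℕ) * y) + y := by ring
      rw [h1, h2, cos_sub, cos_add]
      ring
  have h1 := htel p
  rw [hy, mul_polygonAngle, cos_nat_mul_two_pi, ← hy] at h1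
  nlinarith [cos_le_one y]

/-- Pair `t_d` with `t_{p + 1 - d} = π + π / n - t_d`: the two cotangents have a negative sum. -/
theorem neg_sum_cot_pos (hp : 1 ≤ p) :
    0 < -∑ d ∈ Icc 1 p, cos (polygonAngle p d) / sin (polygonAngle p d) := by
  have hrefl : ∑ d ∈ Icc 1 p, cos (polygonAngle p (p + 1 - d)) / sin (polygonAngle p (p + 1 - d)) =
      ∑ d ∈ Icc 1 p, cos (polygonAngle p d) / sin (polygonAngle p d) := by
    refine Finset.sum_nbij' (fun d => p + 1 - d) (fun d => p + 1 - d) ?_ ?_ ?_ ?_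
      (fun _ _ => rfl) <;> intro d hd <;> simp only [Finset.mem_Icc] at hd ⊢ <;> omega
  have hneg : ∑ d ∈ Icc 1 p, (cos (polygonAngle p d) / sin (polygonAngle p d) +
      cos (polygonAngle p (p + 1 - d)) / sin (polygonAngle p (p + 1 - d))) < 0 := by
    refine Finset.sum_neg (fun d hd => ?_) ⟨1, Finset.mem_Icc.2 ⟨le_rfl, hp⟩⟩
    obtain ⟨h1, h2⟩ := Finset.mem_Icc.1 hd
    have hs := sin_polygonAngle_pos hd
    have hs' := sin_polygonAngle_pos (p := p) (d := p + 1 - d)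
      (Finset.mem_Icc.2 ⟨by omega, by omega⟩)
    rw [div_add_div _ _ hs.ne' hs'.ne']
    refine div_neg_of_neg_of_pos ?_ (mul_pos hs hs')
    have hp' : (0 : ℝ) < 2 * p + 1 := by positivity
    have hsum : polygonAngle p d + polygonAngle p (p + 1 - d) = π / (2 * p + 1) + π := by
      unfold polygonAngle
      rw [Nat.cast_sub (by omega)]
      push_cast
      field_simp
      ring
    have h3 : cos (polygonAngle p d) * sin (polygonAngle p (p + 1 - d)) +
        sin (polygonAngle p d) * cos (polygonAngle p (p + 1 - d)) = -sin (π / (2 * p + 1)) := by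
      rw [← sin_add_pi, ← hsum, sin_add]
      ring
    rw [h3, neg_lt_zero]
    have hp1 : (1 : ℝ) ≤ p := by exact_mod_cast hp
    refine sin_pos_of_pos_of_lt_pi (div_pos pi_pos hp') ?_
    rw [div_lt_iff₀ hp']
    nlinarith [pi_pos]
  rw [Finset.sum_add_distrib, hrefl] at hneg
  linarith

theorem two_mul_polygonAngle (d : ℕ) :
    2 * (p : ℝ) * polygonAngle p d = d * (2 * π) - polygonAngle p d := by
  rw [← mul_polygonAngle]
  ring

/-- The eigenvalues of the force matrix of the regular polygon are nonzero multiples of these sums.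
As a function of `r` the sum is convex, by `sum_sin_nonpos`, zero at `0` and negative at `p`. -/
theorem sum_sin_div_sin_sq_neg (hp : 1 ≤ p) {r : ℕ} (hr0 : 1 ≤ r) (hr : r ≤ p) :
    ∑ d ∈ Icc 1 p, sin (2 * r * polygonAngle p d) / sin (polygonAngle p d) ^ 2 < 0 := by
  set f : ℕ → ℝ := fun r =>
    -∑ d ∈ Icc 1 p, sin (2 * r * polygonAngle p d) / sin (polygonAngle p d) ^ 2 with hf
  have hconc : ∀ r, 1 ≤ r → r < p → f (r + 1) + f (r - 1) ≤ 2 * f r := by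
    intro r h1 h2
    have h3 := sum_sin_nonpos (p := p) (r := r) h2.le
    have h4 : f (r + 1) + f (r - 1) - 2 * f r =
        4 * ∑ d ∈ Icc 1 p, sin (2 * r * polygonAngle p d) := by
      simp only [hf, ← Finset.sum_neg_distrib, Finset.mul_sum, ← Finset.sum_add_distrib,
        ← Finset.sum_sub_distrib]
      refine Finset.sum_congr rfl fun d hd => ?_
      have hs := (sin_polygonAngle_pos hd).ne'
      obtain ⟨q, rfl⟩ : ∃ q, r = q + 1 := ⟨r - 1, by omega⟩
      have e1 : 2 * ((q + 1 + 1 : ℕ) : ℝ) * polygonAngle p d =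
        2 * ((q + 1 : ℕ) : ℝ) * polygonAngle p d + 2 * polygonAngle p d := by push_cast; ring
      have e2 : 2 * ((q + 1 - 1 : ℕ) : ℝ) * polygonAngle p d =
        2 * ((q + 1 : ℕ) : ℝ) * polygonAngle p d - 2 * polygonAngle p d := by
        simp only [Nat.add_sub_cancel]; push_cast; ring
      rw [e1, e2, sin_add, sin_sub, cos_two_mul, cos_sq']
      field_simp
      ring
    linarith
  have hp0 : (1 : ℝ) ≤ p := by exact_mod_cast hp
  have hr0' : (1 : ℝ) ≤ r := by exact_mod_cast hr0
  have hfp : 0 < f p := by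
    simp only [hf, ← Finset.sum_neg_distrib]
    refine Finset.sum_pos (fun d hd => ?_) ⟨1, Finset.mem_Icc.2 ⟨le_rfl, hp⟩⟩
    have hs := sin_polygonAngle_pos hd
    rw [two_mul_polygonAngle, sin_nat_mul_two_pi_sub, neg_div, neg_neg]
    positivity
  have h := mul_le_mul_of_concave (f := f) (by simp [hf]) hconc hr
  have : 0 < f r := by
    by_contra! hcon
    nlinarith
  simpa [hf] using this

/-- The eigenvalues of the Hessian of `-U` at the regular polygon are positive multiples of these
sums. As a function of `r` the increments of the sum are concave, by `sum_sin_nonpos`, positive at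
`0` and zero at `p`, so that the sum increases from its positive value at `r = 1`. -/
theorem sum_cos_div_sin_cube_pos (hp : 1 ≤ p) {r : ℕ} (hr0 : 1 ≤ r) (hr : r ≤ p) :
    0 < ∑ d ∈ Icc 1 p, -cos (polygonAngle p d) / sin (polygonAngle p d) ^ 3 *
      (1 - cos (2 * r * polygonAngle p d)) := by
  set f : ℕ → ℝ := fun r => ∑ d ∈ Icc 1 p, -cos (polygonAngle p d) / sin (polygonAngle p d) ^ 3 *
      (1 - cos (2 * r * polygonAngle p d)) with hf
  set Δ : ℕ → ℝ := fun r => f (r + 1) - f r with hΔ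
  have hf0 : f 0 = 0 := by simp [hf]
  have hf1 : 0 < f 1 := by
    have h1 := neg_sum_cot_pos hp
    have h2 : f 1 = 2 * -∑ d ∈ Icc 1 p, cos (polygonAngle p d) / sin (polygonAngle p d) := by
      simp only [hf, ← Finset.sum_neg_distrib, Finset.mul_sum]
      refine Finset.sum_congr rfl fun d hd => ?_
      have hs := (sin_polygonAngle_pos hd).ne'
      rw [Nat.cast_one, mul_one, cos_two_mul, cos_sq']
      field_simp
      ring
    rw [h2]
    positivity
  have hΔp : Δ p = 0 := by
    simp only [hΔ, hf, ← Finset.sum_sub_distrib]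
    refine Finset.sum_eq_zero fun d hd => ?_
    have e1 : 2 * ((p + 1 : ℕ) : ℝ) * polygonAngle p d = d * (2 * π) + polygonAngle p d := by
      rw [← mul_polygonAngle]; push_cast; ring
    rw [e1, two_mul_polygonAngle, add_comm, cos_add_nat_mul_two_pi, cos_nat_mul_two_pi_sub]
    ring
  have hconc : ∀ r, 1 ≤ r → r < p → Δ (r + 1) + Δ (r - 1) ≤ 2 * Δ r := by
    intro r h1 h2
    have h3 := sum_sin_nonpos (p := p) (r := r) h2.le
    have h5 := sum_sin_nonpos (p := p) (r := r + 1) h2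
    have h4 : Δ (r + 1) + Δ (r - 1) - 2 * Δ r =
        4 * ∑ d ∈ Icc 1 p, sin (2 * r * polygonAngle p d) +
        4 * ∑ d ∈ Icc 1 p, sin (2 * (r + 1 : ℕ) * polygonAngle p d) := by
      obtain ⟨q, rfl⟩ : ∃ q, r = q + 1 := ⟨r - 1, by omega⟩
      simp only [hΔ, hf, Nat.add_sub_cancel, Finset.mul_sum, ← Finset.sum_add_distrib,
        ← Finset.sum_sub_distrib]
      refine Finset.sum_congr rfl fun d hd => ?_
      have hs := (sin_polygonAngle_pos hd).ne'
      set t := polygonAngle p d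
      set v : ℝ := 2 * ((q + 1 : ℕ) : ℝ) * t + t with hv
      have e0 : 2 * (q : ℝ) * t = v - (t + 2 * t) := by rw [hv]; push_cast; ring
      have e1 : 2 * ((q + 1 : ℕ) : ℝ) * t = v - t := by rw [hv]; ring
      have e2 : 2 * ((q + 1 + 1 : ℕ) : ℝ) * t = v + t := by rw [hv]; push_cast; ring
      have e3 : 2 * ((q + 1 + 1 + 1 : ℕ) : ℝ) * t = v + (t + 2 * t) := by
        rw [hv]; push_cast; ring
      rw [e0, e1, e2, e3, cos_sub v, cos_add v, cos_sub v, cos_add v, sin_sub, sin_add v,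
        sin_add t, sin_two_mul, cos_two_mul]
      have hc := cos_sq' t
      field_simp
      ring_nf
      rw [show cos t ^ 3 = cos t * cos t ^ 2 by ring, hc]
      ring
    linarith
  have hp0 : (1 : ℝ) ≤ p := by exact_mod_cast hp
  have hΔ0 : 0 ≤ Δ 0 := by simp only [hΔ, hf0]; simpa using hf1.le
  have hΔpos : ∀ r, r ≤ p → 0 ≤ Δ r := by
    intro r hr
    have h := mul_le_mul_of_concave (f := Δ) hΔ0 hconc hr
    rw [hΔp, mul_zero] at h
    exact nonneg_of_mul_nonneg_right h (by linarith)
  have hmono : f 1 ≤ f r := by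
    induction r, hr0 using Nat.le_induction with
    | base => exact le_rfl
    | succ s hs ih =>
      have h1 := ih (by omega)
      have h2 := hΔpos s (by omega)
      simp only [hΔ] at h2
      linarith
  exact hf1.trans_le hmono

end Trigonometric

end CurvedNBody

/-! ### Circulant matrices and the regular polygon -/

namespace CurvedNBody

open Finset Real
open scoped ZMod

section Circulant

variable {N : ℕ} [NeZero N]

theorem stdAddChar_intCast_re (z : ℤ) :
    (ZMod.stdAddChar (z : ZMod N)).re = cos (2 * π * z / N) := by
  rw [ZMod.stdAddChar_coe]
  rw [show (2 * π * Complex.I * z / N : ℂ) = ((2 * π * z / N : ℝ) : ℂ) * Complex.I by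
    push_cast; ring, Complex.exp_ofReal_mul_I_re]

theorem stdAddChar_intCast_im (z : ℤ) :
    (ZMod.stdAddChar (z : ZMod N)).im = sin (2 * π * z / N) := by
  rw [ZMod.stdAddChar_coe]
  rw [show (2 * π * Complex.I * z / N : ℂ) = ((2 * π * z / N : ℝ) : ℂ) * Complex.I by
    push_cast; ring, Complex.exp_ofReal_mul_I_im]

theorem stdAddChar_neg (d : ZMod N) :
    ZMod.stdAddChar (-d) = (starRingEnd ℂ) (ZMod.stdAddChar d) := by
  obtain ⟨z, rfl⟩ := ZMod.intCast_surjective d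
  rw [← Int.cast_neg]
  apply Complex.ext
  · rw [Complex.conj_re, stdAddChar_intCast_re, stdAddChar_intCast_re, ← cos_neg]
    congr 1; push_cast; ring
  · rw [Complex.conj_im, stdAddChar_intCast_im, stdAddChar_intCast_im, ← sin_neg]
    congr 1; push_cast; ring

theorem normSq_stdAddChar (d : ZMod N) : Complex.normSq (ZMod.stdAddChar d) = 1 := by
  rw [Complex.normSq_apply]
  obtain ⟨z, rfl⟩ := ZMod.intCast_surjective d
  rw [stdAddChar_intCast_re, stdAddChar_intCast_im]
  linarith [sin_sq_add_cos_sq (2 * π * z / N)]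

/-- The Fourier transform diagonalizes circulant matrices; stated for a vector in the kernel. -/
theorem circulant_mul_dft {a f : ZMod N → ℂ} (h : ∀ i, ∑ j, a (j - i) * f j = 0) (k : ZMod N) :
    (∑ d, a d * ZMod.stdAddChar (d * k)) * 𝓕 f k = 0 := by
  have h1 : ∑ i, ∑ j, ZMod.stdAddChar (-(i * k)) * (a (j - i) * f j) = 0 :=
    Finset.sum_eq_zero fun i _ => by rw [← Finset.mul_sum, h, mul_zero]
  rw [Finset.sum_comm] at h1
  rw [ZMod.dft_apply, Finset.mul_sum, ← h1]
  refine Finset.sum_congr rfl fun j _ => ?_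
  rw [Finset.sum_mul]
  refine Fintype.sum_equiv (Equiv.subLeft j) _ _ fun d => ?_
  rw [Equiv.subLeft_apply, sub_sub_cancel, smul_eq_mul,
    show -((j - d) * k) = d * k + -(j * k) by ring, AddChar.map_add_eq_mul]
  ring

theorem eq_of_dft_eq_zero {f : ZMod N → ℂ} (h : ∀ k ≠ 0, 𝓕 f k = 0) (i j : ZMod N) :
    f i = f j := by
  have h1 : ∀ i, f i = (N : ℂ)⁻¹ * 𝓕 f 0 := by
    intro i
    have h2 : f i = ZMod.dft.symm (𝓕 f) i := by rw [LinearEquiv.symm_apply_apply]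
    rw [h2, ZMod.invDFT_apply, Finset.sum_eq_single 0]
    · simp
    · intro k _ hk
      rw [h k hk, smul_zero]
    · simp
  rw [h1 i, h1 j]

/-- Parseval's identity. -/
theorem sum_normSq_dft (f : ZMod N → ℂ) :
    ∑ k, Complex.normSq (𝓕 f k) = N * ∑ j, Complex.normSq (f j) := by
  have h : ∑ k, (starRingEnd ℂ) (𝓕 f k) * 𝓕 f k = N * ∑ j, (starRingEnd ℂ) (f j) * f j := by
    have h1 : ∀ j, ∑ k, ZMod.stdAddChar (j * k) * 𝓕 f k = N * f j := by
      intro j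
      have := congrFun (ZMod.dft_dft f) (-j)
      rw [ZMod.dft_apply] at this
      simp only [neg_neg, smul_eq_mul, mul_neg] at this
      rw [← this]
      exact Finset.sum_congr rfl fun k _ => by rw [mul_comm j k]
    calc _ = ∑ k, ∑ j, (starRingEnd ℂ) (f j) * (ZMod.stdAddChar (j * k) * 𝓕 f k) := by
          refine Finset.sum_congr rfl fun k _ => ?_
          conv_lhs => rw [ZMod.dft_apply f k, map_sum, Finset.sum_mul]
          refine Finset.sum_congr rfl fun j _ => ?_
          rw [smul_eq_mul, map_mul, stdAddChar_neg, Complex.conj_conj, ZMod.dft_apply]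
          ring
      _ = _ := by
          rw [Finset.sum_comm, Finset.mul_sum]
          refine Finset.sum_congr rfl fun j _ => ?_
          rw [← Finset.mul_sum, h1]
          ring
  simp only [← Complex.normSq_eq_conj_mul_self] at h
  exact_mod_cast h

theorem dft_shift (f : ZMod N → ℂ) (d k : ZMod N) :
    𝓕 (fun j => f (j + d)) k = ZMod.stdAddChar (d * k) * 𝓕 f k := by
  rw [ZMod.dft_apply, ZMod.dft_apply, Finset.mul_sum]
  refine Fintype.sum_equiv (Equiv.addRight d) _ _ fun j => ?_
  rw [Equiv.coe_addRight, smul_eq_mul, smul_eq_mul, ← mul_assoc, ← AddChar.map_add_eq_mul]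
  congr 2
  ring

/-- Eigenvalue decomposition of a circulant graph Laplacian. -/
theorem sum_mul_sq_sub_eq (g x : ZMod N → ℝ) :
    N * ∑ d, g d * ∑ j, (x (j + d) - x j) ^ 2 =
      2 * ∑ k, (∑ d, g d * (1 - (ZMod.stdAddChar (d * k)).re)) *
        Complex.normSq (𝓕 (fun j => (x j : ℂ)) k) := by
  have h : ∀ d, N * ∑ j, (x (j + d) - x j) ^ 2 = ∑ k, 2 * (1 - (ZMod.stdAddChar (d * k)).re) *
      Complex.normSq (𝓕 (fun j => (x j : ℂ)) k) := by
    intro d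
    have h1 := sum_normSq_dft (fun j => ((x (j + d) - x j : ℝ) : ℂ))
    simp only [Complex.normSq_ofReal, ← pow_two] at h1
    rw [← h1]
    refine Finset.sum_congr rfl fun k _ => ?_
    have h2 : (fun j => ((x (j + d) - x j : ℝ) : ℂ)) =
        (fun j => (x (j + d) : ℂ)) - fun j => (x j : ℂ) := by
      funext j; simp
    rw [h2, map_sub, Pi.sub_apply, dft_shift (fun j => (x j : ℂ)) d k,
      show ZMod.stdAddChar (d * k) * 𝓕 (fun j => (x j : ℂ)) k - 𝓕 (fun j => (x j : ℂ)) k =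
        (ZMod.stdAddChar (d * k) - 1) * 𝓕 (fun j => (x j : ℂ)) k by ring, Complex.normSq_mul]
    congr 1
    have h3 := normSq_stdAddChar (d * k)
    rw [Complex.normSq_apply] at h3 ⊢
    simp only [Complex.sub_re, Complex.one_re, Complex.sub_im, Complex.one_im, sub_zero]
    linarith
  calc _ = ∑ d, g d * (N * ∑ j, (x (j + d) - x j) ^ 2) := by
        rw [Finset.mul_sum]
        exact Finset.sum_congr rfl fun d _ => by ring
    _ = ∑ d, ∑ k, 2 * (g d * (1 - (ZMod.stdAddChar (d * k)).re) *
          Complex.normSq (𝓕 (fun j => (x j : ℂ)) k)) := by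
        refine Finset.sum_congr rfl fun d _ => ?_
        rw [h, Finset.mul_sum]
        exact Finset.sum_congr rfl fun k _ => by ring
    _ = _ := by
        rw [Finset.sum_comm, Finset.mul_sum]
        refine Finset.sum_congr rfl fun k _ => ?_
        rw [← Finset.mul_sum, Finset.sum_mul]

theorem sum_zmod_eq (p : ℕ) (F : ℕ → ℝ) (h0 : F 0 = 0)
    (hF : ∀ d ∈ Icc 1 p, F (2 * p + 1 - d) = F d) :
    ∑ d : ZMod (2 * p + 1), F d.val = 2 * ∑ d ∈ Icc 1 p, F d := by
  have h1 : ∑ d : ZMod (2 * p + 1), F d.val = ∑ d ∈ range (2 * p + 1), F d :=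
    Fin.sum_univ_eq_sum_range F (2 * p + 1)
  have h2 : range (2 * p + 1) = insert 0 (Icc 1 p ∪ Icc (p + 1) (2 * p)) := by
    ext d; simp only [mem_range, mem_insert, mem_union, Finset.mem_Icc]; omega
  have h3 : ∑ d ∈ Icc (p + 1) (2 * p), F d = ∑ d ∈ Icc 1 p, F d := by
    refine Finset.sum_nbij' (fun d => 2 * p + 1 - d) (fun d => 2 * p + 1 - d) ?_ ?_ ?_ ?_ ?_
    · intro d hd; simp only [Finset.mem_Icc] at hd ⊢; omega
    · intro d hd; simp only [Finset.mem_Icc] at hd ⊢; omega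
    · intro d hd; simp only [Finset.mem_Icc] at hd ⊢; omega
    · intro d hd; simp only [Finset.mem_Icc] at hd ⊢; omega
    · intro d hd
      have := hF (2 * p + 1 - d) (by simp only [Finset.mem_Icc] at hd ⊢; omega)
      rw [← this]
      congr 1
      simp only [Finset.mem_Icc] at hd; omega
  rw [h1, h2, sum_insert (by simp), sum_union, h0, h3]
  · ring
  · rw [Finset.disjoint_left]
    intro d hd hd'
    simp only [Finset.mem_Icc] at hd hd'; omega

end Circulant

section RegularPolygon

variable {p : ℕ}

theorem stdAddChar_eq_polygonAngle (d : ZMod (2 * p + 1)) :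
    (ZMod.stdAddChar d).re = cos (polygonAngle p d.val) ∧
      (ZMod.stdAddChar d).im = sin (polygonAngle p d.val) := by
  have h1 := stdAddChar_intCast_re (N := 2 * p + 1) (d.val : ℤ)
  have h2 := stdAddChar_intCast_im (N := 2 * p + 1) (d.val : ℤ)
  rw [Int.cast_natCast, ZMod.natCast_zmod_val] at h1 h2
  rw [h1, h2]
  constructor <;> · unfold polygonAngle; congr 1; push_cast; rfl

theorem stdAddChar_mul_eq_polygonAngle (d k : ZMod (2 * p + 1)) :
    (ZMod.stdAddChar (d * k)).re = cos (k.val * polygonAngle p d.val) ∧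
      (ZMod.stdAddChar (d * k)).im = sin (k.val * polygonAngle p d.val) := by
  have h1 := stdAddChar_intCast_re (N := 2 * p + 1) ((d.val : ℤ) * k.val)
  have h2 := stdAddChar_intCast_im (N := 2 * p + 1) ((d.val : ℤ) * k.val)
  rw [Int.cast_mul, Int.cast_natCast, Int.cast_natCast, ZMod.natCast_zmod_val,
    ZMod.natCast_zmod_val] at h1 h2
  rw [h1, h2]
  constructor <;> · unfold polygonAngle; congr 1; push_cast; ring

theorem polygonAngle_reflect {d : ℕ} (hd : d ∈ Icc 1 p) :
    polygonAngle p (2 * p + 1 - d) = 2 * π - polygonAngle p d := by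
  have hp' : (0 : ℝ) < 2 * p + 1 := by positivity
  unfold polygonAngle
  rw [Nat.cast_sub (by simp only [Finset.mem_Icc] at hd; omega)]
  push_cast
  field_simp

/-- As `n = 2p + 1` is odd, one of `k` and `n - k` is even, so that up to signs only even multiples
of the angles of the regular polygon occur. -/
theorem exists_even_multiple {k : ℕ} (hk0 : k ≠ 0) (hk : k < 2 * p + 1) :
    ∃ r, 1 ≤ r ∧ r ≤ p ∧
      (∀ d : ℕ, cos (k * polygonAngle p d) = cos (2 * r * polygonAngle p d)) ∧
      ((∀ d : ℕ, sin (k * polygonAngle p d) = sin (2 * r * polygonAngle p d)) ∨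
        ∀ d : ℕ, sin (k * polygonAngle p d) = -sin (2 * r * polygonAngle p d)) := by
  rcases Nat.even_or_odd' k with ⟨r, rfl | rfl⟩
  · exact ⟨r, by omega, by omega, fun d => by push_cast; rfl, Or.inl fun d => by push_cast; rfl⟩
  · have e : ∀ d : ℕ, ((2 * r + 1 : ℕ) : ℝ) * polygonAngle p d =
        d * (2 * π) - 2 * ((p - r : ℕ) : ℝ) * polygonAngle p d := by
      intro d
      rw [← mul_polygonAngle (p := p), Nat.cast_sub (by omega)]
      push_cast
      ring
    refine ⟨p - r, by omega, by omega, fun d => ?_, Or.inr fun d => ?_⟩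
    · rw [e, cos_nat_mul_two_pi_sub]
    · rw [e, sin_nat_mul_two_pi_sub]

/-- The eigenvalues of the force matrix of the regular polygon, other than the one that belongs to
equal masses, do not vanish. The summand at `d = 0` is `0 / 0 = 0`. -/
theorem sum_force_stdAddChar_ne_zero (hp : 1 ≤ p) {k : ZMod (2 * p + 1)} (hk : k ≠ 0) :
    ∑ d : ZMod (2 * p + 1), (((ZMod.stdAddChar d).im / |(ZMod.stdAddChar d).im| ^ 3 : ℝ) : ℂ) *
      ZMod.stdAddChar (d * k) ≠ 0 := by
  intro h
  have him := congrArg Complex.im h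
  rw [Complex.im_sum] at him
  simp only [Complex.im_ofReal_mul, Complex.zero_im] at him
  set F : ℕ → ℝ := fun d => sin (polygonAngle p d) / |sin (polygonAngle p d)| ^ 3 *
    sin (k.val * polygonAngle p d) with hF
  have h1 : ∑ d : ZMod (2 * p + 1), F d.val = 0 := by
    rw [← him]
    refine Finset.sum_congr rfl fun d _ => ?_
    rw [(stdAddChar_mul_eq_polygonAngle d k).2, (stdAddChar_eq_polygonAngle d).2]
  rw [sum_zmod_eq p F (by simp [hF, polygonAngle])] at h1
  · obtain ⟨r, hr0, hr, -, hs⟩ := exists_even_multiple (p := p)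
      (by simpa using hk) (ZMod.val_lt k)
    have hneg := sum_sin_div_sin_sq_neg hp hr0 hr
    have hFd : ∀ d ∈ Icc 1 p, F d =
        sin (k.val * polygonAngle p d) / sin (polygonAngle p d) ^ 2 := by
      intro d hd
      have hsd := sin_polygonAngle_pos hd
      simp only [hF]
      rw [abs_of_pos hsd]
      field_simp
    rw [Finset.sum_congr rfl hFd] at h1
    rcases hs with hs | hs <;> simp only [hs, neg_div, Finset.sum_neg_distrib] at h1 <;> linarith
  · intro d hd
    simp only [hF]
    rw [polygonAngle_reflect hd, mul_sub, sin_two_pi_sub, abs_neg, sin_nat_mul_two_pi_sub]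
    ring

/-- The eigenvalues of the Hessian of `-U` at the regular polygon in the longitudes, other than the
one that belongs to rotations, are positive. -/
theorem sum_hessian_stdAddChar_pos (hp : 1 ≤ p) {k : ZMod (2 * p + 1)} (hk : k ≠ 0) :
    0 < ∑ d : ZMod (2 * p + 1), -(ZMod.stdAddChar d).re / |(ZMod.stdAddChar d).im| ^ 3 *
      (1 - (ZMod.stdAddChar (d * k)).re) := by
  set F : ℕ → ℝ := fun d => -cos (polygonAngle p d) / |sin (polygonAngle p d)| ^ 3 *
    (1 - cos (k.val * polygonAngle p d)) with hF
  have h1 : ∑ d : ZMod (2 * p + 1), -(ZMod.stdAddChar d).re / |(ZMod.stdAddChar d).im| ^ 3 *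
      (1 - (ZMod.stdAddChar (d * k)).re) = ∑ d : ZMod (2 * p + 1), F d.val := by
    refine Finset.sum_congr rfl fun d _ => ?_
    rw [(stdAddChar_mul_eq_polygonAngle d k).1, (stdAddChar_eq_polygonAngle d).2,
      (stdAddChar_eq_polygonAngle d).1]
  rw [h1, sum_zmod_eq p F (by simp [hF, polygonAngle])]
  · obtain ⟨r, hr0, hr, hc, -⟩ := exists_even_multiple (p := p)
      (by simpa using hk) (ZMod.val_lt k)
    have hpos := sum_cos_div_sin_cube_pos hp hr0 hr
    refine mul_pos two_pos (hpos.trans_eq (Finset.sum_congr rfl fun d hd => ?_))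
    simp only [hF]
    rw [hc, abs_of_pos (sin_polygonAngle_pos hd)]
  · intro d hd
    simp only [hF]
    rw [polygonAngle_reflect hd, mul_sub (k.val : ℝ), sin_two_pi_sub, abs_neg,
      cos_nat_mul_two_pi_sub, cos_two_pi_sub]

/-- The longitudes of the vertices of `regularPolygon n`. -/
noncomputable def regularAngle (n : ℕ) (i : Fin n) : ℝ := 2 * π * ((i : ℕ) + 1) / n

theorem regularAngle_sub {n : ℕ} [NeZero n] (i j : Fin n) :
    cos (regularAngle n j - regularAngle n i) =
        (ZMod.stdAddChar (((j : ℕ) : ZMod n) - ((i : ℕ) : ZMod n))).re ∧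
      sin (regularAngle n j - regularAngle n i) =
        (ZMod.stdAddChar (((j : ℕ) : ZMod n) - ((i : ℕ) : ZMod n))).im := by
  have h1 := stdAddChar_intCast_re (N := n) ((j : ℕ) - (i : ℕ) : ℤ)
  have h2 := stdAddChar_intCast_im (N := n) ((j : ℕ) - (i : ℕ) : ℤ)
  push_cast at h1 h2
  rw [h1, h2, regularAngle, regularAngle]
  constructor <;> · congr 1; ring

/-- The bijection of the indices of the bodies with the residue classes modulo `n`. -/
def indexEquiv (n : ℕ) [NeZero n] : Fin n ≃ ZMod n where
  toFun i := ((i : ℕ) : ZMod n)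
  invFun z := ⟨z.val, ZMod.val_lt z⟩
  left_inv i := Fin.ext (ZMod.val_cast_of_lt i.2)
  right_inv z := ZMod.natCast_zmod_val z

/-- Only equal masses make the regular polygon with an odd number of vertices an equilibrium. -/
theorem eq_of_regular_force_eq_zero (hp : 1 ≤ p) {m : Fin (2 * p + 1) → ℝ}
    (h : ∀ i, ∑ j, sin (regularAngle (2 * p + 1) j - regularAngle (2 * p + 1) i) /
      |sin (regularAngle (2 * p + 1) j - regularAngle (2 * p + 1) i)| ^ 3 * m j = 0)
    (i j : Fin (2 * p + 1)) : m i = m j := by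
  set e := indexEquiv (2 * p + 1) with he
  set f : ZMod (2 * p + 1) → ℂ := fun z => (m (e.symm z) : ℂ) with hf
  have hcirc : ∀ i, ∑ j, (((ZMod.stdAddChar (j - i)).im /
      |(ZMod.stdAddChar (j - i)).im| ^ 3 : ℝ) : ℂ) * f j = 0 := by
    intro i
    have h1 := h (e.symm i)
    have h2 : ∑ j, (((ZMod.stdAddChar (j - i)).im /
      |(ZMod.stdAddChar (j - i)).im| ^ 3 : ℝ)) * m (e.symm j) = 0 := by
      rw [← h1]
      symm
      refine Fintype.sum_equiv e _ _ fun j => ?_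
      rw [(regularAngle_sub (e.symm i) j).2, Equiv.symm_apply_apply]
      rw [show (((e.symm i : Fin (2 * p + 1)) : ℕ) : ZMod (2 * p + 1)) = i from
        e.apply_symm_apply i]
      rfl
    simp only [hf]
    exact_mod_cast h2
  have hdft : ∀ k ≠ 0, 𝓕 f k = 0 := fun k hk =>
    (mul_eq_zero.1 (circulant_mul_dft (a := fun d => (((ZMod.stdAddChar d).im /
      |(ZMod.stdAddChar d).im| ^ 3 : ℝ) : ℂ)) hcirc k)).resolve_left
        (sum_force_stdAddChar_ne_zero hp hk)
  have := eq_of_dft_eq_zero hdft (e i) (e j)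
  simp only [hf, Equiv.symm_apply_apply] at this
  exact_mod_cast this

/-- For equal masses the regular polygon with an odd number of vertices is, up to rotations, a
nondegenerate minimum of `-U` on the equator. -/
theorem regular_hessian_pos (hp : 1 ≤ p) {x : Fin (2 * p + 1) → ℝ} (hx : ∃ i j, x i ≠ x j) :
    0 < ∑ i, ∑ j, -cos (regularAngle (2 * p + 1) j - regularAngle (2 * p + 1) i) /
      |sin (regularAngle (2 * p + 1) j - regularAngle (2 * p + 1) i)| ^ 3 * (x j - x i) ^ 2 := by
  set e := indexEquiv (2 * p + 1) with he
  set y : ZMod (2 * p + 1) → ℝ := fun z => x (e.symm z) with hy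
  set g : ZMod (2 * p + 1) → ℝ := fun d =>
    -(ZMod.stdAddChar d).re / |(ZMod.stdAddChar d).im| ^ 3 with hg
  have h1 : ∑ i, ∑ j, -cos (regularAngle (2 * p + 1) j - regularAngle (2 * p + 1) i) /
      |sin (regularAngle (2 * p + 1) j - regularAngle (2 * p + 1) i)| ^ 3 * (x j - x i) ^ 2 =
      ∑ d, g d * ∑ j, (y (j + d) - y j) ^ 2 := by
    simp only [Finset.mul_sum]
    rw [Finset.sum_comm (s := univ (α := ZMod (2 * p + 1)))]
    refine Fintype.sum_equiv e _ _ fun i => ?_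
    refine Fintype.sum_equiv (e.trans (Equiv.subRight (e i))) _ _ fun j => ?_
    rw [(regularAngle_sub i j).1, (regularAngle_sub i j).2]
    simp only [hy, hg, Equiv.trans_apply, Equiv.subRight_apply, add_sub_cancel,
      Equiv.symm_apply_apply]
    rfl
  rw [h1]
  have h2 := sum_mul_sq_sub_eq g y
  have h3 : 0 < ∑ k, (∑ d, g d * (1 - (ZMod.stdAddChar (d * k)).re)) *
        Complex.normSq (𝓕 (fun j => (y j : ℂ)) k) := by
    have hnn : ∀ k ∈ univ, 0 ≤ (∑ d, g d * (1 - (ZMod.stdAddChar (d * k)).re)) *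
        Complex.normSq (𝓕 (fun j => (y j : ℂ)) k) := by
      intro k _
      by_cases hk : k = 0
      · simp [hk]
      · exact mul_nonneg (sum_hessian_stdAddChar_pos hp hk).le (Complex.normSq_nonneg _)
    refine Finset.sum_pos' hnn ?_
    by_contra! hcon
    obtain ⟨i, j, hij⟩ := hx
    have hdft : ∀ k ≠ 0, 𝓕 (fun j => (y j : ℂ)) k = 0 := by
      intro k hk
      have h4 := le_antisymm (hcon k (mem_univ k)) (hnn k (mem_univ k))
      exact Complex.normSq_eq_zero.1
        ((mul_eq_zero.1 h4).resolve_left (sum_hessian_stdAddChar_pos hp hk).ne')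
    have := eq_of_dft_eq_zero hdft (e i) (e j)
    simp only [hy, Equiv.symm_apply_apply] at this
    exact hij (by exact_mod_cast this)
  have hN : (0 : ℝ) < ((2 * p + 1 : ℕ) : ℝ) := by positivity
  have h5 : 0 < ((2 * p + 1 : ℕ) : ℝ) * ∑ d, g d * ∑ j, (y (j + d) - y j) ^ 2 := by
    rw [h2]; positivity
  exact (pos_iff_pos_of_mul_pos h5).1 hN

end RegularPolygon

end CurvedNBody

/-! ### Equilibrium configurations near the regular polygon -/

namespace CurvedNBody

open Finset Real Filter Topology

/-- Near the regular polygon with an odd number of vertices, every equilibrium configuration on the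
equator is a nondegenerate minimum of `-U` on the equator, up to rotations, whatever its masses
are: by `eq_of_regular_force_eq_zero` these are nearly equal up to a factor, and the claim for equal
masses persists by compactness of the set of normalized masses and displacements. -/
theorem exists_hessian_pos_near_regular {p : ℕ} (hp : 1 ≤ p) :
    ∃ ε : ℝ, 0 < ε ∧ ∀ m φ : Fin (2 * p + 1) → ℝ, (∀ i, 0 < m i) →
      (∀ i, dist (equatorPoint (φ i)) (regularPolygon (2 * p + 1) i) < ε) →
      (∀ i, ∑ j, sin (φ j - φ i) / |sin (φ j - φ i)| ^ 3 * m j = 0) →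
      ∀ x : Fin (2 * p + 1) → ℝ, (∃ i j, x i ≠ x j) →
        0 < ∑ i, ∑ j, m i * m j * (-cos (φ j - φ i) / |sin (φ j - φ i)| ^ 3 * (x j - x i) ^ 2) := by
  -- the sine and the cosine of the difference of two longitudes, as functions of the points
  let S : (Fin (2 * p + 1) → R4) → Fin (2 * p + 1) → Fin (2 * p + 1) → ℝ :=
    fun q i j => q i 0 * q j 1 - q i 1 * q j 0
  let C : (Fin (2 * p + 1) → R4) → Fin (2 * p + 1) → Fin (2 * p + 1) → ℝ :=
    fun q i j => q i 0 * q j 0 + q i 1 * q j 1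
  have hS : ∀ (φ : Fin (2 * p + 1) → ℝ) i j, S (fun i => equatorPoint (φ i)) i j =
      sin (φ j - φ i) := by
    intro φ i j
    simp [S, equatorPoint, spherePoint, sin_sub]
    ring
  have hC : ∀ (φ : Fin (2 * p + 1) → ℝ) i j, C (fun i => equatorPoint (φ i)) i j =
      cos (φ j - φ i) := by
    intro φ i j
    simp [C, equatorPoint, spherePoint, cos_sub]
    ring
  have hreg : regularPolygon (2 * p + 1) =
      fun i => equatorPoint (regularAngle (2 * p + 1) i) := rfl
  have hSreg : ∀ i j, i ≠ j → S (regularPolygon (2 * p + 1)) i j ≠ 0 := by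
    intro i j hij
    rw [hreg, hS, (regularAngle_sub i j).2, (stdAddChar_eq_polygonAngle _).2]
    set d := (((j : ℕ) : ZMod (2 * p + 1)) - ((i : ℕ) : ZMod (2 * p + 1))).val with hd
    have hd0 : d ≠ 0 := by
      rw [hd, Ne, ZMod.val_eq_zero, sub_eq_zero]
      exact fun h => hij ((indexEquiv (2 * p + 1)).injective h.symm)
    have hdlt : d < 2 * p + 1 := ZMod.val_lt _
    by_cases hdp : d ≤ p
    · exact (sin_polygonAngle_pos (Finset.mem_Icc.2 ⟨by omega, hdp⟩)).ne'
    · have hmem : 2 * p + 1 - d ∈ Icc 1 p := Finset.mem_Icc.2 ⟨by omega, by omega⟩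
      have h1 := polygonAngle_reflect hmem
      rw [show 2 * p + 1 - (2 * p + 1 - d) = d by omega] at h1
      rw [h1, sin_two_pi_sub]
      exact neg_ne_zero.2 (sin_polygonAngle_pos hmem).ne'
  have hScont : ∀ i j, Continuous fun q => S q i j := fun i j => by
    simp only [S]; fun_prop
  have hCcont : ∀ i j, Continuous fun q => C q i j := fun i j => by
    simp only [C]; fun_prop
  let F : (Fin (2 * p + 1) → R4) → (Fin (2 * p + 1) → ℝ) → Fin (2 * p + 1) → ℝ :=
    fun q m i => ∑ j, S q i j / |S q i j| ^ 3 * m j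
  let Q : (Fin (2 * p + 1) → R4) → (Fin (2 * p + 1) → ℝ) → (Fin (2 * p + 1) → ℝ) → ℝ :=
    fun q m x => ∑ i, ∑ j, m i * m j * (-C q i j / |S q i j| ^ 3 * (x j - x i) ^ 2)
  have hFcont : ∀ m x i, ContinuousAt
      (fun z : (Fin (2 * p + 1) → R4) × (Fin (2 * p + 1) → ℝ) × (Fin (2 * p + 1) → ℝ) =>
        F z.1 z.2.1 i) (regularPolygon (2 * p + 1), m, x) := by
    intro m x i
    refine tendsto_finsetSum _ fun j _ => ?_
    change ContinuousAt _ _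
    by_cases hij : i = j
    · -- the diagonal terms are constant, with the value `0 / 0 = 0`
      subst hij
      have : ∀ q, S q i i = 0 := fun q => by simp only [S]; ring
      simp only [this, zero_div, zero_mul]
      exact continuousAt_const
    · refine ContinuousAt.mul (ContinuousAt.div ?_ ?_ ?_) (by fun_prop)
      · exact ((hScont i j).comp continuous_fst).continuousAt
      · exact (((hScont i j).comp continuous_fst).abs.pow 3).continuousAt
      · exact pow_ne_zero _ (abs_ne_zero.2 (hSreg i j hij))
  have hQcont : ∀ m x, ContinuousAt
      (fun z : (Fin (2 * p + 1) → R4) × (Fin (2 * p + 1) → ℝ) × (Fin (2 * p + 1) → ℝ) =>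
        Q z.1 z.2.1 z.2.2) (regularPolygon (2 * p + 1), m, x) := by
    intro m x
    refine tendsto_finsetSum _ fun i _ => tendsto_finsetSum _ fun j _ => ?_
    change ContinuousAt _ _
    by_cases hij : i = j
    · subst hij
      simp only [sub_self, ne_eq, OfNat.ofNat_ne_zero, not_false_eq_true, zero_pow, mul_zero]
      exact continuousAt_const
    · refine ContinuousAt.mul (by fun_prop)
        (ContinuousAt.mul (ContinuousAt.div ?_ ?_ ?_) (by fun_prop))
      · exact ((hCcont i j).comp continuous_fst).neg.continuousAt
      · exact (((hScont i j).comp continuous_fst).abs.pow 3).continuousAt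
      · exact pow_ne_zero _ (abs_ne_zero.2 (hSreg i j hij))
  -- normalized masses and normalized displacements that are orthogonal to the rotations
  let K : Set ((Fin (2 * p + 1) → ℝ) × (Fin (2 * p + 1) → ℝ)) :=
    stdSimplex ℝ (Fin (2 * p + 1)) ×ˢ (Metric.sphere 0 1 ∩ {x | ∑ i, x i = 0})
  have hK : IsCompact K := (isCompact_stdSimplex ℝ (Fin (2 * p + 1))).prod
    ((isCompact_sphere _ _).inter_right (isClosed_eq (by fun_prop) continuous_const))
  -- the condition is open in `(q, m, x)` and holds on `{q̄} × K`, where `q̄` is the regular polygon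
  have hev : ∀ᶠ q in 𝓝 (regularPolygon (2 * p + 1)), ∀ y ∈ K,
      (∃ i, F q y.1 i ≠ 0) ∨ 0 < Q q y.1 y.2 := by
    refine hK.eventually_forall_of_forall_eventually fun y hy => ?_
    obtain ⟨m, x⟩ := y
    obtain ⟨⟨hm0, hm1⟩, hx1, hx0⟩ := hy
    by_cases hF : ∃ i, F (regularPolygon (2 * p + 1)) m i ≠ 0
    · obtain ⟨i, hi⟩ := hF
      filter_upwards [(hFcont m x i).eventually_ne hi] with z hz
      exact Or.inl ⟨i, hz⟩
    · push Not at hF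
      have hmeq := eq_of_regular_force_eq_zero hp (m := m) fun i => by
        rw [← hF i]
        simp only [F, hreg, hS]
      obtain ⟨a, ha⟩ : ∃ a, ∀ i, m i = a := ⟨m 0, fun i => hmeq i 0⟩
      have ha0 : a ≠ 0 := by
        rintro rfl
        simp [ha] at hm1
      have hxne : ∃ i j, x i ≠ x j := by
        by_contra! hcon
        have hx2 : ∀ i, x i = 0 := by
          intro i
          have h2 : ∑ j, x j = (2 * p + 1 : ℕ) * x i := by
            rw [Finset.sum_congr rfl fun j _ => hcon j i]; simp
          rw [show ∑ j, x j = 0 from hx0] at h2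
          exact (mul_eq_zero.1 h2.symm).resolve_left (by positivity)
        have : x = 0 := funext hx2
        simp [this] at hx1
      have hpos := regular_hessian_pos hp hxne
      have hQ : 0 < Q (regularPolygon (2 * p + 1)) m x := by
        have : Q (regularPolygon (2 * p + 1)) m x = a * a * ∑ i, ∑ j,
            -cos (regularAngle (2 * p + 1) j - regularAngle (2 * p + 1) i) /
            |sin (regularAngle (2 * p + 1) j - regularAngle (2 * p + 1) i)| ^ 3 *
              (x j - x i) ^ 2 := by
          simp only [Q, hreg, hS, hC, ha, Finset.mul_sum]
        rw [this]
        exact mul_pos (mul_self_pos.2 ha0) hpos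
      filter_upwards [(hQcont m x).eventually (eventually_gt_nhds hQ)] with z hz
      exact Or.inr hz
  obtain ⟨ε, hε, hε'⟩ := Metric.eventually_nhds_iff.1 hev
  refine ⟨ε, hε, fun m φ hm hdist hF x hx => ?_⟩
  have hq := hε' (y := fun i => equatorPoint (φ i)) ((dist_pi_lt_iff hε).2 hdist)
  have hM : 0 < ∑ i, m i := Finset.sum_pos (fun i _ => hm i) univ_nonempty
  set a := ∑ i, x i / (2 * p + 1 : ℕ) with ha
  set y : Fin (2 * p + 1) → ℝ := fun i => x i - a with hy
  have hy0 : y ≠ 0 := by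
    obtain ⟨i, j, hij⟩ := hx
    intro h
    have h1 := congrFun h i
    have h2 := congrFun h j
    simp only [hy, Pi.zero_apply, sub_eq_zero] at h1 h2
    exact hij (h1.trans h2.symm)
  have hyn : 0 < ‖y‖ := norm_pos_iff.2 hy0
  have hmem : ((fun i => m i / ∑ i, m i, ‖y‖⁻¹ • y) :
      (Fin (2 * p + 1) → ℝ) × (Fin (2 * p + 1) → ℝ)) ∈ K := by
    refine ⟨⟨fun i => (div_pos (hm i) hM).le, ?_⟩, ?_, ?_⟩
    · rw [← Finset.sum_div, div_self hM.ne']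
    · simp [norm_smul, inv_mul_cancel₀ hyn.ne']
    · change ∑ i, ‖y‖⁻¹ * (x i - a) = 0
      rw [← Finset.mul_sum, Finset.sum_sub_distrib]
      have hn : ((2 * p + 1 : ℕ) : ℝ) ≠ 0 := by positivity
      simp only [sum_const, card_univ, Fintype.card_fin, nsmul_eq_mul]
      rw [ha, ← Finset.sum_div, mul_div_cancel₀ _ hn, sub_self, mul_zero]
  rcases hq _ hmem with ⟨i, hi⟩ | hpos
  · refine absurd ?_ hi
    have := hF i
    simp only [F, hS]
    simp only [← mul_div_assoc, ← Finset.sum_div]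
    rw [this, zero_div]
  · have : Q (fun i => equatorPoint (φ i)) (fun i => m i / ∑ i, m i) (‖y‖⁻¹ • y) =
        ((∑ i, m i)⁻¹ * ‖y‖⁻¹) ^ 2 * ∑ i, ∑ j, m i * m j *
          (-cos (φ j - φ i) / |sin (φ j - φ i)| ^ 3 * (x j - x i) ^ 2) := by
      simp only [Q, hS, hC, Finset.mul_sum]
      refine Finset.sum_congr rfl fun i _ => Finset.sum_congr rfl fun j _ => ?_
      simp only [hy, Pi.smul_apply, smul_eq_mul]
      ring
    simp only at hpos
    rw [this] at hpos
    exact pos_of_mul_pos_right hpos (sq_nonneg _)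

end CurvedNBody

/-! ### Second-order expansion of the Hamiltonian along lines -/

namespace CurvedNBody

open Finset Real Filter Topology

theorem cot_arccos {c : ℝ} (h : |c| ≤ 1) : Real.cot (arccos c) = c / √(1 - c ^ 2) := by
  obtain ⟨h1, h2⟩ := abs_le.1 h
  rw [Real.cot_eq_cos_div_sin, cos_arccos h1 h2, sin_arccos]

theorem inner_spherePoint (a b θ θ' : ℝ) :
    inner ℝ (spherePoint a θ) (spherePoint b θ') =
      sin θ * sin θ' * cos (a - b) + cos θ * cos θ' := by
  simp only [spherePoint, PiLp.inner_apply, Fin.sum_univ_four, cos_sub]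
  simp
  ring

theorem norm_spherePoint (a θ : ℝ) : ‖spherePoint a θ‖ = 1 := by
  have h : inner ℝ (spherePoint a θ) (spherePoint a θ) = (1 : ℝ) := by
    rw [inner_spherePoint, sub_self, cos_zero]
    linarith [sin_sq_add_cos_sq θ]
  rw [real_inner_self_eq_norm_sq] at h
  nlinarith [norm_nonneg (spherePoint a θ)]

theorem cot_sphDist_spherePoint (a b θ θ' : ℝ) :
    Real.cot (sphDist (spherePoint a θ) (spherePoint b θ')) =
      (sin θ * sin θ' * cos (a - b) + cos θ * cos θ') /
        √(1 - (sin θ * sin θ' * cos (a - b) + cos θ * cos θ') ^ 2) := by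
  rw [sphDist, cot_arccos, inner_spherePoint]
  have := abs_real_inner_le_norm (spherePoint a θ) (spherePoint b θ')
  rwa [norm_spherePoint, norm_spherePoint, one_mul] at this

theorem hasDerivAt_div_sqrt {c : ℝ → ℝ} {c' t : ℝ} (hc : HasDerivAt c c' t)
    (h : 0 < 1 - c t ^ 2) :
    HasDerivAt (fun t => c t / √(1 - c t ^ 2)) (c' / √(1 - c t ^ 2) ^ 3) t := by
  have hs : 0 < √(1 - c t ^ 2) := sqrt_pos.2 h
  have h1 : HasDerivAt (fun t => √(1 - c t ^ 2)) (-(c t * c') / √(1 - c t ^ 2)) t := by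
    have := ((hc.pow 2).const_sub 1).sqrt h.ne'
    refine this.congr_deriv ?_
    simp
    field_simp
  refine (hc.div h1 hs.ne').congr_deriv ?_
  have h2 : √(1 - c t ^ 2) ^ 2 = 1 - c t ^ 2 := sq_sqrt h.le
  field_simp
  rw [h2]
  ring

/-- Expansion of the mutual cotangent potential of two bodies that start on the equator. -/
theorem pair_expansion {δ : ℝ} (hδ : sin δ ≠ 0) (ξ a b : ℝ) :
    ∃ f' : ℝ → ℝ,
      (∀ᶠ t in 𝓝 (0 : ℝ), HasDerivAt (fun t =>
        (cos (t * a) * cos (t * b) * cos (δ + t * ξ) + sin (t * a) * sin (t * b)) /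
          √(1 - (cos (t * a) * cos (t * b) * cos (δ + t * ξ) + sin (t * a) * sin (t * b)) ^ 2))
        (f' t) t) ∧
      f' 0 = -sin δ * ξ / |sin δ| ^ 3 ∧
      HasDerivAt f'
        ((2 * cos δ * ξ ^ 2 + 2 * a * b - cos δ * (a ^ 2 + b ^ 2)) / |sin δ| ^ 3) 0 := by
  set c : ℝ → ℝ := fun t =>
    cos (t * a) * cos (t * b) * cos (δ + t * ξ) + sin (t * a) * sin (t * b) with hc
  set c' : ℝ → ℝ := fun t => (-sin (t * a) * a * cos (t * b) + cos (t * a) * (-sin (t * b) * b)) *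
    cos (δ + t * ξ) + cos (t * a) * cos (t * b) * (-sin (δ + t * ξ) * ξ) +
    (cos (t * a) * a * sin (t * b) + sin (t * a) * (cos (t * b) * b)) with hc'
  have hlin : ∀ s t : ℝ, HasDerivAt (fun t => t * s) s t := fun s t => by
    simpa using (hasDerivAt_id t).mul_const s
  have hcd : ∀ t, HasDerivAt c (c' t) t := by
    intro t
    exact (((hlin a t).cos.mul (hlin b t).cos).mul ((hlin ξ t).const_add δ).cos).add
      ((hlin a t).sin.mul (hlin b t).sin)
  have hcc : HasDerivAt c' (-ξ ^ 2 * cos δ + 2 * a * b - cos δ * (a ^ 2 + b ^ 2)) 0 := by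
    have := ((((((hlin a 0).sin.neg.mul_const a).mul (hlin b 0).cos).add
      ((hlin a 0).cos.mul ((hlin b 0).sin.neg.mul_const b))).mul ((hlin ξ 0).const_add δ).cos).add
      (((hlin a 0).cos.mul (hlin b 0).cos).mul (((hlin ξ 0).const_add δ).sin.neg.mul_const ξ))).add
      ((((hlin a 0).cos.mul_const a).mul (hlin b 0).sin).add
        ((hlin a 0).sin.mul ((hlin b 0).cos.mul_const b)))
    refine this.congr_deriv ?_
    simp
    ring
  have hc0 : c 0 = cos δ := by simp [hc]
  have hc'0 : c' 0 = -sin δ * ξ := by simp [hc']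
  have hsq : 1 - c 0 ^ 2 = sin δ ^ 2 := by rw [hc0, sin_sq]
  have hpos0 : 0 < 1 - c 0 ^ 2 := by rw [hsq]; positivity
  have hcont : Continuous fun t => 1 - c t ^ 2 := by simp only [hc]; fun_prop
  have hroot : √(1 - c 0 ^ 2) = |sin δ| := by rw [hsq, sqrt_sq_eq_abs]
  have habs0 : |sin δ| ≠ 0 := abs_ne_zero.2 hδ
  refine ⟨fun t => c' t / √(1 - c t ^ 2) ^ 3, ?_, ?_, ?_⟩
  · filter_upwards [hcont.continuousAt.eventually (eventually_gt_nhds hpos0)] with t ht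
    exact hasDerivAt_div_sqrt (hcd t) ht
  · simp only [hc'0, hroot]
  · have h1 : HasDerivAt (fun t => √(1 - c t ^ 2)) (-(c 0 * c' 0) / √(1 - c 0 ^ 2)) 0 := by
      refine ((((hcd 0).pow 2).const_sub 1).sqrt hpos0.ne').congr_deriv ?_
      simp
      field_simp
    have h2 := hcc.div (h1.pow 3) (pow_ne_zero 3 (sqrt_pos.2 hpos0).ne')
    refine h2.congr_deriv ?_
    rw [hc0] at hroot
    simp only [Pi.pow_apply, hc0, hc'0, hroot]
    have h3 : sin δ ^ 4 = |sin δ| ^ 4 := ((show Even 4 by decide).pow_abs _).symm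
    have h4 : sin δ ^ 2 = |sin δ| ^ 2 := (sq_abs _).symm
    field_simp
    rw [h4]
    norm_num
    field_simp
    linear_combination 3 * ξ ^ 2 * cos δ * h3

/-- Expansion of the kinetic energy of the longitude of a body that starts on the equator. -/
theorem kinetic_expansion {m : ℝ} (hm : m ≠ 0) (α y a : ℝ) :
    ∃ f' : ℝ → ℝ,
      (∀ᶠ t in 𝓝 (0 : ℝ), HasDerivAt (fun t => (m * α + t * y) ^ 2 / (2 * m * cos (t * a) ^ 2))
        (f' t) t) ∧
      f' 0 = α * y ∧ HasDerivAt f' (y ^ 2 / m + m * α ^ 2 * a ^ 2) 0 := by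
  have hlin : ∀ s t : ℝ, HasDerivAt (fun t => t * s) s t := fun s t => by
    simpa using (hasDerivAt_id t).mul_const s
  have hcont : Continuous fun t => cos (t * a) := by fun_prop
  refine ⟨fun t => (m * α + t * y) * y / (m * cos (t * a) ^ 2) +
    (m * α + t * y) ^ 2 * (a * sin (t * a)) / (m * cos (t * a) ^ 3), ?_, ?_, ?_⟩
  · filter_upwards [hcont.continuousAt.eventually_ne (show cos (0 * a) ≠ 0 by simp)] with t ht
    refine ((((hlin y t).const_add (m * α)).pow 2).div
      (((hlin a t).cos.pow 2).const_mul (2 * m)) (by simp; tauto)).congr_deriv ?_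
    simp only [Pi.pow_apply]
    field_simp
    ring
  · simp
    field_simp
  · have h1 := (((hlin y 0).const_add (m * α)).mul_const y).div
      (((hlin a 0).cos.pow 2).const_mul m) (by simpa using hm)
    have h2 := ((((hlin y 0).const_add (m * α)).pow 2).mul ((hlin a 0).sin.const_mul a)).div
      (((hlin a 0).cos.pow 3).const_mul m) (by simpa using hm)
    refine (h1.add h2).congr_deriv ?_
    simp
    field_simp

theorem two_mul_sum_Ioi {n : ℕ} (G : Fin n → Fin n → ℝ) (hsymm : ∀ i j, G i j = G j i)
    (hdiag : ∀ i, G i i = 0) : 2 * ∑ i, ∑ j ∈ Ioi i, G i j = ∑ i, ∑ j, G i j := by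
  have h1 : ∀ i, ∑ j, G i j = ∑ j ∈ Ioi i, G i j + ∑ j ∈ Iio i, G i j := by
    intro i
    have hu : (univ : Finset (Fin n)) = insert i (Ioi i ∪ Iio i) := by
      ext j
      simp only [mem_univ, mem_insert, mem_union, Finset.mem_Ioi, Finset.mem_Iio, true_iff]
      rcases lt_trichotomy i j with h | h | h <;> simp [h]
    rw [hu, sum_insert (by simp), hdiag, zero_add, sum_union]
    rw [Finset.disjoint_left]
    intro j hj hj'
    exact absurd (Finset.mem_Ioi.1 hj) (Finset.mem_Iio.1 hj').asymm
  have h2 : ∑ i, ∑ j ∈ Iio i, G i j = ∑ i, ∑ j ∈ Ioi i, G i j := by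
    rw [Finset.sum_comm' (t' := univ) (s' := fun j => Ioi j) (by simp)]
    exact Finset.sum_congr rfl fun i _ => Finset.sum_congr rfl fun j _ => hsymm _ _
  simp only [h1, Finset.sum_add_distrib, h2]
  ring

/-- The coefficient `m_i m_j / sin³ d_ij` of two bodies on the equator. For `i = j` it has the value
`0`, as a quotient by `0`, so that sums over all pairs `(i, j)` may include the diagonal. -/
noncomputable def coupling {n : ℕ} (m φ : Fin n → ℝ) (i j : Fin n) : ℝ :=
  m i * m j / |sin (φ j - φ i)| ^ 3

theorem coupling_comm {n : ℕ} (m φ : Fin n → ℝ) (i j : Fin n) :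
    coupling m φ i j = coupling m φ j i := by
  rw [coupling, coupling, ← neg_sub, sin_neg, abs_neg, mul_comm]

theorem coupling_self {n : ℕ} (m φ : Fin n → ℝ) (i : Fin n) : coupling m φ i i = 0 := by
  simp [coupling]

theorem cos_sub_comm (a b : ℝ) : cos (a - b) = cos (b - a) := by
  rw [← neg_sub, cos_neg]

/-- The symmetric bilinear form of the Hessian of the potential `U`, at a configuration on the
equator, in the latitudes. -/
noncomputable def latitudeForm {n : ℕ} (m φ w w' : Fin n → ℝ) : ℝ :=
  ∑ i, ∑ j, coupling m φ i j * (w i * w' j - cos (φ j - φ i) * (w i * w' i))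

/-- The quadratic form of the Hessian of `-U`, at a configuration on the equator, in the
longitudes. -/
noncomputable def longitudeForm {n : ℕ} (m φ x : Fin n → ℝ) : ℝ :=
  ∑ i, ∑ j, -(coupling m φ i j * cos (φ j - φ i) * (x j - x i) ^ 2)

/-- Expansion of the Hamiltonian at a rotating equilibrium configuration on the equator, along lines
on which the angular momentum is constant: the linear terms cancel and the quadratic ones do not
mix longitudes, latitudes and momenta. -/
theorem sphericalHamiltonian_expansion {n : ℕ} {m φ : Fin n → ℝ} (hm : ∀ i, 0 < m i)
    (hφ : ∀ i j, i ≠ j → sin (φ j - φ i) ≠ 0)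
    (heq : ∀ i, ∑ j, coupling m φ i j * sin (φ j - φ i) = 0) (α : ℝ) (x y w z : Fin n → ℝ)
    (hy : ∑ i, y i = 0) :
    ∃ h' : ℝ → ℝ,
      (∀ᶠ t in 𝓝 (0 : ℝ), HasDerivAt (fun t => sphericalHamiltonian m (fun i => φ i + t * x i)
        (fun i => π / 2 + t * w i) (fun i => m i * α + t * y i) (fun i => t * z i)) (h' t) t) ∧
      h' 0 = 0 ∧
      HasDerivAt h' (∑ i, (y i ^ 2 / m i + z i ^ 2 / m i) + longitudeForm m φ x +
        (α ^ 2 * ∑ i, m i * w i ^ 2 - latitudeForm m φ w w)) 0 := by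
  have hm0 : ∀ i, m i ≠ 0 := fun i => (hm i).ne'
  choose k hk hk0 hk2 using fun i => kinetic_expansion (hm0 i) α (y i) (w i)
  have hpair : ∀ i j, ∃ f' : ℝ → ℝ, (i < j →
      (∀ᶠ t in 𝓝 (0 : ℝ), HasDerivAt (fun t =>
        (cos (t * w i) * cos (t * w j) * cos (φ i - φ j + t * (x i - x j)) +
          sin (t * w i) * sin (t * w j)) /
          √(1 - (cos (t * w i) * cos (t * w j) * cos (φ i - φ j + t * (x i - x j)) +
          sin (t * w i) * sin (t * w j)) ^ 2)) (f' t) t)) ∧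
      (i < j → f' 0 = -sin (φ i - φ j) * (x i - x j) / |sin (φ i - φ j)| ^ 3) ∧
      (i < j → HasDerivAt f' ((2 * cos (φ i - φ j) * (x i - x j) ^ 2 + 2 * w i * w j -
        cos (φ i - φ j) * (w i ^ 2 + w j ^ 2)) / |sin (φ i - φ j)| ^ 3) 0) := by
    intro i j
    by_cases hij : i < j
    · obtain ⟨f', h1, h2, h3⟩ := pair_expansion (hφ j i hij.ne') (x i - x j) (w i) (w j)
      exact ⟨f', fun _ => h1, fun _ => h2, fun _ => h3⟩
    · exact ⟨0, fun h => absurd h hij, fun h => absurd h hij, fun h => absurd h hij⟩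
  choose f hf hf0 hf2 using hpair
  have hH : (fun t => sphericalHamiltonian m (fun i => φ i + t * x i)
        (fun i => π / 2 + t * w i) (fun i => m i * α + t * y i) (fun i => t * z i)) = fun t =>
      (∑ i, ((m i * α + t * y i) ^ 2 / (2 * m i * cos (t * w i) ^ 2) +
        (t * z i) ^ 2 / (2 * m i))) - ∑ i, ∑ j ∈ Ioi i, m i * m j *
        ((cos (t * w i) * cos (t * w j) * cos (φ i - φ j + t * (x i - x j)) +
          sin (t * w i) * sin (t * w j)) /
          √(1 - (cos (t * w i) * cos (t * w j) * cos (φ i - φ j + t * (x i - x j)) +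
          sin (t * w i) * sin (t * w j)) ^ 2)) := by
    funext t
    have hs : ∀ s, sin (π / 2 + s) = cos s := fun s => by rw [add_comm, sin_add_pi_div_two]
    have hc : ∀ s, cos (π / 2 + s) = -sin s := fun s => by rw [add_comm, cos_add_pi_div_two]
    simp only [sphericalHamiltonian, potential, cot_sphDist_spherePoint, hs, hc, neg_mul_neg,
      show ∀ i j, φ i + t * x i - (φ j + t * x j) = φ i - φ j + t * (x i - x j) from
        fun i j => by ring]
  rw [hH]
  have hlin : ∀ s t : ℝ, HasDerivAt (fun t => t * s) s t := fun s t => by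
    simpa using (hasDerivAt_id t).mul_const s
  refine ⟨fun t => (∑ i, (k i t + t * (z i ^ 2 / m i))) -
    ∑ i, ∑ j ∈ Ioi i, m i * m j * f i j t, ?_, ?_, ?_⟩
  · have h1 : ∀ᶠ t in 𝓝 (0 : ℝ), ∀ i, HasDerivAt
        (fun t => (m i * α + t * y i) ^ 2 / (2 * m i * cos (t * w i) ^ 2)) (k i t) t :=
      eventually_all.2 hk
    have h2 : ∀ᶠ t in 𝓝 (0 : ℝ), ∀ i j, i < j → HasDerivAt (fun t =>
        (cos (t * w i) * cos (t * w j) * cos (φ i - φ j + t * (x i - x j)) +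
          sin (t * w i) * sin (t * w j)) /
          √(1 - (cos (t * w i) * cos (t * w j) * cos (φ i - φ j + t * (x i - x j)) +
          sin (t * w i) * sin (t * w j)) ^ 2)) (f i j t) t := by
      refine eventually_all.2 fun i => eventually_all.2 fun j => ?_
      by_cases hij : i < j
      · filter_upwards [hf i j hij] with t ht _ using ht
      · exact Eventually.of_forall fun t h => absurd h hij
    filter_upwards [h1, h2] with t ht1 ht2
    refine HasDerivAt.fun_sub (HasDerivAt.fun_sum fun i _ => (ht1 i).fun_add ?_)
      (HasDerivAt.fun_sum fun i _ => HasDerivAt.fun_sum fun j hj =>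
        (ht2 i j (Finset.mem_Ioi.1 hj)).const_mul _)
    refine (((hlin (z i) t).pow 2).div_const (2 * m i)).congr_deriv ?_
    simp
    have := hm0 i
    field_simp
  · have h1 : ∑ i, ∑ j ∈ Ioi i, m i * m j * f i j 0 =
        ∑ i, ∑ j ∈ Ioi i, -(coupling m φ i j * sin (φ j - φ i) * (x j - x i)) := by
      refine Finset.sum_congr rfl fun i _ => Finset.sum_congr rfl fun j hj => ?_
      rw [hf0 i j (Finset.mem_Ioi.1 hj), coupling, ← neg_sub (φ j) (φ i), sin_neg, abs_neg]
      ring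
    have h2 := two_mul_sum_Ioi (fun i j => -(coupling m φ i j * sin (φ j - φ i) * (x j - x i)))
      (fun i j => by
        rw [coupling_comm, ← neg_sub (φ i) (φ j), sin_neg]; ring)
      (fun i => by simp)
    have h3 : ∑ i, ∑ j, -(coupling m φ i j * sin (φ j - φ i) * (x j - x i)) = 0 := by
      have e1 : ∑ i, ∑ j, coupling m φ i j * sin (φ j - φ i) * x i = 0 :=
        Finset.sum_eq_zero fun i _ => by rw [← Finset.sum_mul, heq, zero_mul]
      have e2 : ∑ i, ∑ j, coupling m φ i j * sin (φ j - φ i) * x j = 0 := by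
        rw [Finset.sum_comm]
        refine Finset.sum_eq_zero fun j _ => ?_
        rw [← Finset.sum_mul]
        have : ∑ i, coupling m φ i j * sin (φ j - φ i) =
            -∑ i, coupling m φ j i * sin (φ i - φ j) := by
          rw [← Finset.sum_neg_distrib]
          refine Finset.sum_congr rfl fun i _ => ?_
          rw [coupling_comm, ← neg_sub (φ i) (φ j), sin_neg]; ring
        rw [this, heq, neg_zero, zero_mul]
      simp only [mul_sub, neg_sub, Finset.sum_sub_distrib, e1, e2, sub_zero]
    simp only [hk0, zero_mul, add_zero, h1]
    rw [← Finset.mul_sum, hy]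
    linarith
  · have h1 : HasDerivAt (fun t => (∑ i, (k i t + t * (z i ^ 2 / m i))) -
        ∑ i, ∑ j ∈ Ioi i, m i * m j * f i j t)
        ((∑ i, ((y i ^ 2 / m i + m i * α ^ 2 * w i ^ 2) + z i ^ 2 / m i)) -
          ∑ i, ∑ j ∈ Ioi i, m i * m j * ((2 * cos (φ i - φ j) * (x i - x j) ^ 2 + 2 * w i * w j -
        cos (φ i - φ j) * (w i ^ 2 + w j ^ 2)) / |sin (φ i - φ j)| ^ 3)) 0 :=
      HasDerivAt.fun_sub (HasDerivAt.fun_sum fun i _ => (hk2 i).fun_add (hlin _ 0))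
        (HasDerivAt.fun_sum fun i _ => HasDerivAt.fun_sum fun j hj =>
          (hf2 i j (Finset.mem_Ioi.1 hj)).const_mul _)
    refine h1.congr_deriv ?_
    have h2 : ∑ i, ∑ j ∈ Ioi i, m i * m j * ((2 * cos (φ i - φ j) * (x i - x j) ^ 2 +
        2 * w i * w j - cos (φ i - φ j) * (w i ^ 2 + w j ^ 2)) / |sin (φ i - φ j)| ^ 3) =
        ∑ i, ∑ j ∈ Ioi i, coupling m φ i j * (2 * cos (φ j - φ i) * (x j - x i) ^ 2 +
          2 * (w i * w j) - cos (φ j - φ i) * (w i ^ 2 + w j ^ 2)) := by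
      refine Finset.sum_congr rfl fun i _ => Finset.sum_congr rfl fun j hj => ?_
      rw [coupling, ← neg_sub (φ j) (φ i), sin_neg, abs_neg, cos_neg]
      ring
    have h3 := two_mul_sum_Ioi (fun i j => coupling m φ i j *
        (2 * cos (φ j - φ i) * (x j - x i) ^ 2 +
          2 * (w i * w j) - cos (φ j - φ i) * (w i ^ 2 + w j ^ 2)))
      (fun i j => by
        rw [coupling_comm, cos_sub_comm]; ring)
      (fun i => by rw [coupling_self, zero_mul])
    have h4 : ∑ i, ∑ j, coupling m φ i j * (2 * cos (φ j - φ i) * (x j - x i) ^ 2 +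
          2 * (w i * w j) - cos (φ j - φ i) * (w i ^ 2 + w j ^ 2)) =
        2 * (latitudeForm m φ w w - longitudeForm m φ x) := by
      have e1 : ∑ i, ∑ j, coupling m φ i j * cos (φ j - φ i) * w j ^ 2 =
          ∑ i, ∑ j, coupling m φ i j * cos (φ j - φ i) * w i ^ 2 := by
        rw [Finset.sum_comm]
        refine Finset.sum_congr rfl fun i _ => Finset.sum_congr rfl fun j hj => ?_
        rw [coupling_comm, cos_sub_comm]
      have e2 : ∑ i, ∑ j, coupling m φ i j * (2 * cos (φ j - φ i) * (x j - x i) ^ 2 +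
          2 * (w i * w j) - cos (φ j - φ i) * (w i ^ 2 + w j ^ 2)) =
          2 * (latitudeForm m φ w w - longitudeForm m φ x) +
          (∑ i, ∑ j, coupling m φ i j * cos (φ j - φ i) * w i ^ 2 -
            ∑ i, ∑ j, coupling m φ i j * cos (φ j - φ i) * w j ^ 2) := by
        simp only [latitudeForm, longitudeForm, ← Finset.sum_sub_distrib, Finset.mul_sum,
          ← Finset.sum_add_distrib]
        exact Finset.sum_congr rfl fun i _ => Finset.sum_congr rfl fun j _ => by ring
      rw [e2, e1]
      ring
    rw [h2]
    rw [h4] at h3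
    have h5 : ∑ i, ((y i ^ 2 / m i + m i * α ^ 2 * w i ^ 2) + z i ^ 2 / m i) =
        ∑ i, (y i ^ 2 / m i + z i ^ 2 / m i) + α ^ 2 * ∑ i, m i * w i ^ 2 := by
      rw [Finset.mul_sum, ← Finset.sum_add_distrib]
      exact Finset.sum_congr rfl fun i _ => by ring
    rw [h5]
    linarith

end CurvedNBody

/-! ### The Hessian of the reduced Hamiltonian and the stability threshold -/

namespace CurvedNBody

open Finset Real Filter Topology
open scoped Matrix

theorem inner_equatorPoint (a b : ℝ) : inner ℝ (equatorPoint a) (equatorPoint b) = cos (a - b) := by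
  simp [equatorPoint, inner_spherePoint]

theorem IsEquilibriumConfiguration.sin_sub_ne_zero {n : ℕ} {m φ : Fin n → ℝ}
    (h : IsEquilibriumConfiguration m (fun i => equatorPoint (φ i))) {i j : Fin n} (hij : i ≠ j) :
    sin (φ j - φ i) ≠ 0 := by
  intro hs
  have hn : ∀ a, ‖equatorPoint a‖ = 1 := fun a => norm_spherePoint a _
  have hsq := sin_sq_add_cos_sq (φ j - φ i)
  rw [hs] at hsq
  have hc : cos (φ j - φ i) = 1 ∨ cos (φ j - φ i) = -1 := by
    rw [← sq_eq_one_iff]; linarith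
  obtain ⟨h1, h2⟩ := h.2.1 j i hij.symm
  rcases hc with hc | hc
  · exact h1 ((inner_eq_one_iff_of_norm_eq_one (𝕜 := ℝ) (hn _) (hn _)).1
      ((inner_equatorPoint _ _).trans hc))
  · refine h2 ((inner_eq_one_iff_of_norm_eq_one (𝕜 := ℝ) (hn _) (by rw [norm_neg, hn])).1 ?_)
    rw [inner_neg_right, inner_equatorPoint, hc, neg_neg]

theorem IsEquilibriumConfiguration.sum_coupling_mul_sin {n : ℕ} {m φ : Fin n → ℝ}
    (h : IsEquilibriumConfiguration m (fun i => equatorPoint (φ i))) (i : Fin n) :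
    ∑ j, coupling m φ i j * sin (φ j - φ i) = 0 := by
  have h1 := h.2.2 i
  -- the component of the force along the equator
  have h2 := congrArg (fun v : R4 => -sin (φ i) * v 0 + cos (φ i) * v 1) h1
  simp only [WithLp.ofLp_sum, Finset.sum_apply, Finset.mul_sum, ← Finset.sum_add_distrib,
    PiLp.zero_apply, mul_zero, add_zero] at h2
  rw [← Finset.add_sum_erase _ _ (mem_univ i), coupling_self, zero_mul, zero_add, ← h2]
  refine Finset.sum_congr rfl fun j _ => ?_
  have h3 : sin (sphDist (equatorPoint (φ i)) (equatorPoint (φ j))) = |sin (φ j - φ i)| := by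
    rw [sphDist, inner_equatorPoint, sin_arccos, cos_sub_comm, ← sin_sq, sqrt_sq_eq_abs]
  rw [h3, coupling]
  simp [equatorPoint, spherePoint, sin_sub]
  ring

section Lift

variable {k : ℕ}

/-- The longitudes with Jacobi coordinates `(u, 0)`, for the part `u` of a point of the reduced
phase space. -/
noncomputable def liftLongitude (m : Fin (k + 1) → ℝ) (u : ReducedPhase k) : Fin (k + 1) → ℝ :=
  (jacobiMatrix m)⁻¹ *ᵥ (Fin.snoc (α := fun _ => ℝ) (fun i => u.1 (Sum.inl i)) 0)

/-- The momenta of the longitudes with conjugate Jacobi momenta `(v, c)`, for the part `v` of a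
point of the reduced phase space; their sum is `c`. -/
noncomputable def liftMomentum (m : Fin (k + 1) → ℝ) (c : ℝ) (u : ReducedPhase k) :
    Fin (k + 1) → ℝ :=
  (jacobiMatrix m)ᵀ *ᵥ (Fin.snoc (α := fun _ => ℝ) (fun i => u.2 (Sum.inl i)) c)

variable {m : Fin (k + 1) → ℝ}

theorem snoc_add_smul (a b : Fin k → ℝ) (c d t : ℝ) :
    (Fin.snoc (α := fun _ => ℝ) (a + t • b) (c + t * d) : Fin (k + 1) → ℝ) =
      Fin.snoc (α := fun _ => ℝ) a c + t • (Fin.snoc (α := fun _ => ℝ) b d : Fin (k + 1) → ℝ) := by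
  funext r
  induction r using Fin.lastCases with
  | last => simp
  | cast i => simp

theorem liftLongitude_add_smul (u v : ReducedPhase k) (t : ℝ) :
    liftLongitude m (u + t • v) = liftLongitude m u + t • liftLongitude m v := by
  have := snoc_add_smul (fun i => u.1 (Sum.inl i)) (fun i => v.1 (Sum.inl i)) 0 0 t
  rw [mul_zero, add_zero] at this
  rw [liftLongitude, liftLongitude, liftLongitude, ← Matrix.mulVec_smul, ← Matrix.mulVec_add,
    ← this]
  rfl

theorem liftMomentum_add_smul (u v : ReducedPhase k) (c d t : ℝ) :
    liftMomentum m (c + t * d) (u + t • v) = liftMomentum m c u + t • liftMomentum m d v := by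
  have := snoc_add_smul (fun i => u.2 (Sum.inl i)) (fun i => v.2 (Sum.inl i)) c d t
  rw [liftMomentum, liftMomentum, liftMomentum, ← Matrix.mulVec_smul, ← Matrix.mulVec_add, ← this]
  rfl

theorem jacobiMatrix_mulVec_liftLongitude (hm : ∀ i, 0 < m i) (u : ReducedPhase k) :
    jacobiMatrix m *ᵥ liftLongitude m u =
      Fin.snoc (α := fun _ => ℝ) (fun i => u.1 (Sum.inl i)) 0 := by
  rw [liftLongitude, Matrix.mulVec_mulVec, Matrix.mul_nonsing_inv _ (jacobiMatrix_isUnit_det hm),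
    Matrix.one_mulVec]

theorem sum_liftMomentum (hm : ∀ i, 0 < m i) (c : ℝ) (u : ReducedPhase k) :
    ∑ i, liftMomentum m c u i = c := by
  have h : ∑ i, liftMomentum m c u i = (1 : Fin (k + 1) → ℝ) ⬝ᵥ liftMomentum m c u := by
    simp [dotProduct]
  rw [h, liftMomentum, Matrix.mulVec_transpose, dotProduct_comm, ← Matrix.dotProduct_mulVec,
    jacobiMatrix_mulVec_one hm]
  simp

theorem liftLongitude_reduceState (hm : ∀ i, 0 < m i) (φ θ pφ pθ : Fin (k + 1) → ℝ) :
    ∃ g, liftLongitude m (reduceState m φ θ pφ pθ) = fun i => φ i + g := by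
  refine ⟨-(jacobiMatrix m *ᵥ φ) (Fin.last k), ?_⟩
  set g := -(jacobiMatrix m *ᵥ φ) (Fin.last k) with hg
  have hu := (Matrix.isUnit_iff_isUnit_det _).2 (jacobiMatrix_isUnit_det hm)
  refine (Matrix.mulVec_injective_iff_isUnit.2 hu) ?_
  have h1 : (fun i => φ i + g) = φ + g • (1 : Fin (k + 1) → ℝ) := by
    funext i; simp
  rw [jacobiMatrix_mulVec_liftLongitude hm, h1, Matrix.mulVec_add, Matrix.mulVec_smul,
    jacobiMatrix_mulVec_one hm]
  funext r
  induction r using Fin.lastCases with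
  | last => simp [hg]
  | cast i => simp [reduceState, (Fin.castSucc_lt_last i).ne]

theorem liftMomentum_reduceState (hm : ∀ i, 0 < m i) (φ θ pφ pθ : Fin (k + 1) → ℝ) :
    liftMomentum m (angularMomentum pφ) (reduceState m φ θ pφ pθ) = pφ := by
  have hAT : IsUnit (jacobiMatrix m)ᵀ.det := by
    rw [Matrix.det_transpose]; exact jacobiMatrix_isUnit_det hm
  set s := (jacobiMatrix m)ᵀ⁻¹ *ᵥ pφ with hs
  have hw : (jacobiMatrix m)ᵀ *ᵥ s = pφ := by
    rw [hs, Matrix.mulVec_mulVec, Matrix.mul_nonsing_inv _ hAT, Matrix.one_mulVec]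
  have hsnoc : ∀ c, (Fin.snoc (α := fun _ => ℝ) (fun i : Fin k => s i.castSucc) c :
      Fin (k + 1) → ℝ) = s + (c - s (Fin.last k)) • Pi.single (Fin.last k) 1 := by
    intro c
    funext r
    induction r using Fin.lastCases with
    | last => simp
    | cast i => simp [(Fin.castSucc_lt_last i).ne]
  have h1 : ∀ c, liftMomentum m c (reduceState m φ θ pφ pθ) = pφ + (c - s (Fin.last k)) •
      ((jacobiMatrix m)ᵀ *ᵥ Pi.single (Fin.last k) 1) := by
    intro c
    rw [liftMomentum]
    simp only [reduceState, Sum.elim_inl]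
    rw [← hs, hsnoc, Matrix.mulVec_add, hw, Matrix.mulVec_smul]
  have h2 : s (Fin.last k) = angularMomentum pφ := by
    have h3 := sum_liftMomentum hm (s (Fin.last k)) (reduceState m φ θ pφ pθ)
    rw [h1, sub_self, zero_smul, add_zero] at h3
    exact h3.symm
  rw [h1, h2, sub_self, zero_smul, add_zero]

theorem liftLongitude_eq_zero_of_const (hm : ∀ i, 0 < m i) {u : ReducedPhase k}
    (h : ∀ i j, liftLongitude m u i = liftLongitude m u j) : ∀ i, u.1 (Sum.inl i) = 0 := by
  have h1 : liftLongitude m u = liftLongitude m u 0 • (1 : Fin (k + 1) → ℝ) := by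
    funext i; simpa using h i 0
  have h2 := jacobiMatrix_mulVec_liftLongitude hm u
  rw [h1, Matrix.mulVec_smul, jacobiMatrix_mulVec_one hm] at h2
  intro i
  have := congrFun h2 i.castSucc
  simpa [(Fin.castSucc_lt_last i).ne] using this.symm

theorem eq_zero_of_liftMomentum_eq_zero (hm : ∀ i, 0 < m i) {u : ReducedPhase k}
    (h : liftMomentum m 0 u = 0) : ∀ i, u.2 (Sum.inl i) = 0 := by
  have hAT : IsUnit (jacobiMatrix m)ᵀ := by
    rw [Matrix.isUnit_iff_isUnit_det, Matrix.det_transpose]; exact jacobiMatrix_isUnit_det hm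
  have h1 := (Matrix.mulVec_injective_iff_isUnit.2 hAT) (h.trans (Matrix.mulVec_zero _).symm)
  intro i
  simpa using congrFun h1 i.castSucc

end Lift

section Smooth

theorem contDiffAt_cot_sphDist {E : Type*} [NormedAddCommGroup E] [NormedSpace ℝ E]
    {a b θ θ' : E → ℝ} {x : E} {N : WithTop ℕ∞} (ha : ContDiffAt ℝ N a x) (hb : ContDiffAt ℝ N b x)
    (hθ : ContDiffAt ℝ N θ x) (hθ' : ContDiffAt ℝ N θ' x)
    (h : 1 - (sin (θ x) * sin (θ' x) * cos (a x - b x) + cos (θ x) * cos (θ' x)) ^ 2 ≠ 0) :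
    ContDiffAt ℝ N (fun y =>
      Real.cot (sphDist (spherePoint (a y) (θ y)) (spherePoint (b y) (θ' y)))) x := by
  simp only [cot_sphDist_spherePoint]
  have hc : ContDiffAt ℝ N (fun y => sin (θ y) * sin (θ' y) * cos (a y - b y) +
      cos (θ y) * cos (θ' y)) x :=
    ((hθ.sin.mul hθ'.sin).mul (ha.sub hb).cos).add (hθ.cos.mul hθ'.cos)
  have hpos : 0 < 1 - (sin (θ x) * sin (θ' x) * cos (a x - b x) + cos (θ x) * cos (θ' x)) ^ 2 := by
    refine lt_of_le_of_ne ?_ h.symm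
    have := abs_real_inner_le_norm (spherePoint (a x) (θ x)) (spherePoint (b x) (θ' x))
    rw [norm_spherePoint, norm_spherePoint, one_mul, inner_spherePoint] at this
    have := (sq_le_one_iff_abs_le_one _).2 this
    linarith
  exact hc.div ((contDiffAt_const.sub (hc.pow 2)).sqrt hpos.ne') (sqrt_pos.2 hpos).ne'

variable {k : ℕ} {m : Fin (k + 1) → ℝ}

theorem contDiff_snoc {a : ReducedPhase k → Fin k → ℝ} {N : WithTop ℕ∞} (ha : ContDiff ℝ N a)
    (c : ℝ) (r : Fin (k + 1)) :
    ContDiff ℝ N (fun u => (Fin.snoc (α := fun _ => ℝ) (a u) c : Fin (k + 1) → ℝ) r) := by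
  induction r using Fin.lastCases with
  | last => simpa using contDiff_const
  | cast i => simpa using contDiff_pi.1 ha i

theorem contDiff_liftLongitude (i : Fin (k + 1)) {N : WithTop ℕ∞} :
    ContDiff ℝ N (fun u : ReducedPhase k => liftLongitude m u i) := by
  simp only [liftLongitude, Matrix.mulVec, dotProduct]
  exact ContDiff.sum fun r _ => contDiff_const.mul (contDiff_snoc (by fun_prop) _ r)

theorem contDiff_liftMomentum (c : ℝ) (i : Fin (k + 1)) {N : WithTop ℕ∞} :
    ContDiff ℝ N (fun u : ReducedPhase k => liftMomentum m c u i) := by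
  simp only [liftMomentum, Matrix.mulVec, dotProduct]
  exact ContDiff.sum fun r _ => contDiff_const.mul (contDiff_snoc (by fun_prop) _ r)

variable {φ : Fin (k + 1) → ℝ}

theorem contDiffAt_reducedHamiltonian (hm : ∀ i, 0 < m i)
    (hφ : ∀ i j, i ≠ j → sin (φ j - φ i) ≠ 0) (c α : ℝ) :
    ContDiffAt ℝ 2 (reducedHamiltonian m c) (reducedEquilibrium m φ α) := by
  have hθ : ∀ i : Fin (k + 1), ContDiffAt ℝ 2 (fun u : ReducedPhase k => u.1 (Sum.inr i))
      (reducedEquilibrium m φ α) := fun i => by fun_prop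
  have hp : ∀ i : Fin (k + 1), ContDiffAt ℝ 2 (fun u : ReducedPhase k => u.2 (Sum.inr i))
      (reducedEquilibrium m φ α) := fun i => by fun_prop
  have hθ0 : ∀ i, (reducedEquilibrium m φ α).1 (Sum.inr i) = π / 2 := fun i => rfl
  have hL : ∀ i, ContDiffAt ℝ 2 (fun u : ReducedPhase k => liftLongitude m u i)
      (reducedEquilibrium m φ α) := fun i => (contDiff_liftLongitude i).contDiffAt
  have hM : ∀ i, ContDiffAt ℝ 2 (fun u : ReducedPhase k => liftMomentum m c u i)
      (reducedEquilibrium m φ α) := fun i => (contDiff_liftMomentum c i).contDiffAt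
  change ContDiffAt ℝ 2 (fun u : ReducedPhase k =>
    (∑ i, (liftMomentum m c u i ^ 2 / (2 * m i * sin (u.1 (Sum.inr i)) ^ 2) +
      u.2 (Sum.inr i) ^ 2 / (2 * m i))) - ∑ i, ∑ j ∈ Ioi i, m i * m j *
        Real.cot (sphDist (spherePoint (liftLongitude m u i) (u.1 (Sum.inr i)))
          (spherePoint (liftLongitude m u j) (u.1 (Sum.inr j))))) _
  refine ContDiffAt.sub (ContDiffAt.sum fun i _ => ?_) (ContDiffAt.sum fun i _ =>
    ContDiffAt.sum fun j hj => contDiffAt_const.mul ?_)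
  · refine (((hM i).pow 2).div (contDiffAt_const.mul ((hθ i).sin.pow 2)) ?_).add
      (((hp i).pow 2).div_const _)
    rw [hθ0, sin_pi_div_two]
    have := (hm i).ne'
    positivity
  · refine contDiffAt_cot_sphDist (hL i) (hL j) (hθ i) (hθ j) ?_
    obtain ⟨g, hg⟩ := liftLongitude_reduceState hm φ (fun _ => π / 2) (rotationMomenta m α)
      (fun _ => 0)
    rw [hθ0, hθ0, sin_pi_div_two, cos_pi_div_two, reducedEquilibrium, hg, mul_zero, add_zero,
      one_mul, one_mul, add_sub_add_right_eq_sub, ← sin_sq]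
    exact pow_ne_zero 2 (hφ j i (Finset.mem_Ioi.1 hj).ne')

theorem reducedHamiltonian_line (hm : ∀ i, 0 < m i) (α : ℝ) (u : ReducedPhase k) (t : ℝ) :
    reducedHamiltonian m (angularMomentum (rotationMomenta m α))
      (reducedEquilibrium m φ α + t • u) =
    sphericalHamiltonian m (fun i => φ i + t * liftLongitude m u i)
      (fun i => π / 2 + t * u.1 (Sum.inr i)) (fun i => m i * α + t * liftMomentum m 0 u i)
      (fun i => t * u.2 (Sum.inr i)) := by
  obtain ⟨g, hg⟩ := liftLongitude_reduceState hm φ (fun _ => π / 2) (rotationMomenta m α)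
    (fun _ => 0)
  have hM := liftMomentum_add_smul (m := m) (reducedEquilibrium m φ α) u
    (angularMomentum (rotationMomenta m α)) 0 t
  rw [mul_zero, add_zero, reducedEquilibrium, liftMomentum_reduceState hm] at hM
  have hL := liftLongitude_add_smul (m := m) (reducedEquilibrium m φ α) u t
  rw [reducedEquilibrium, hg] at hL
  change sphericalHamiltonian m (liftLongitude m (reducedEquilibrium m φ α + t • u)) _
    (liftMomentum m (angularMomentum (rotationMomenta m α))
      (reducedEquilibrium m φ α + t • u)) _ = _
  rw [reducedEquilibrium, hM, hL]
  have h1 : ((fun i => φ i + g) + t • liftLongitude m u) =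
      fun i => (φ i + t * liftLongitude m u i) + g := by
    funext i; simp only [Pi.add_apply, Pi.smul_apply, smul_eq_mul]; ring
  rw [h1]
  unfold sphericalHamiltonian
  rw [potential_rotate m (fun i => φ i + t * liftLongitude m u i)]
  simp [reduceState, rotationMomenta]

/-- The quadratic form of the Hessian of the reduced Hamiltonian at the relative equilibrium of
angular velocity `α`. Displacements of the reduced phase space are lifted to displacements of the
longitudes and their momenta without angular momentum. -/
noncomputable def hessianForm (m φ : Fin (k + 1) → ℝ) (α : ℝ) (u : ReducedPhase k) : ℝ :=
  ∑ i, (liftMomentum m 0 u i ^ 2 / m i + u.2 (Sum.inr i) ^ 2 / m i) +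
    longitudeForm m φ (liftLongitude m u) +
    (α ^ 2 * ∑ i, m i * u.1 (Sum.inr i) ^ 2 -
      latitudeForm m φ (fun i => u.1 (Sum.inr i)) fun i => u.1 (Sum.inr i))

theorem fderiv_reducedHamiltonian (hm : ∀ i, 0 < m i)
    (hφ : ∀ i j, i ≠ j → sin (φ j - φ i) ≠ 0)
    (heq : ∀ i, ∑ j, coupling m φ i j * sin (φ j - φ i) = 0) (α : ℝ) :
    fderiv ℝ (reducedHamiltonian m (angularMomentum (rotationMomenta m α)))
        (reducedEquilibrium m φ α) = 0 ∧
      ∀ u, fderiv ℝ (fderiv ℝ (reducedHamiltonian m (angularMomentum (rotationMomenta m α))))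
        (reducedEquilibrium m φ α) u u = hessianForm m φ α u := by
  have hH := contDiffAt_reducedHamiltonian hm hφ (angularMomentum (rotationMomenta m α)) α
  have hline : ∀ u, _ := fun u : ReducedPhase k =>
    sphericalHamiltonian_expansion hm hφ heq α (liftLongitude m u) (liftMomentum m 0 u)
      (fun i => u.1 (Sum.inr i)) (fun i => u.2 (Sum.inr i)) (sum_liftMomentum hm 0 u)
  simp only [← reducedHamiltonian_line hm] at hline
  constructor
  · refine ContinuousLinearMap.ext fun u => ?_
    obtain ⟨h', h1, h2, -⟩ := hline u
    have h3 := h1.self_of_nhds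
    rw [h2] at h3
    exact fderiv_apply_eq_of_line (hH.differentiableAt (by simp)) h3
  · intro u
    obtain ⟨h', h1, -, h3⟩ := hline u
    exact fderiv_fderiv_apply_eq_of_line hH h1 h3

theorem reducedEquilibrium_isEquilibriumPoint (hm : ∀ i, 0 < m i)
    (hφ : ∀ i j, i ≠ j → sin (φ j - φ i) ≠ 0)
    (heq : ∀ i, ∑ j, coupling m φ i j * sin (φ j - φ i) = 0) (α : ℝ) :
    IsEquilibriumPoint (reducedVectorField m (angularMomentum (rotationMomenta m α)))
      (reducedEquilibrium m φ α) := by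
  have h := (fderiv_reducedHamiltonian hm hφ heq α).1
  rw [IsEquilibriumPoint, reducedVectorField, hamiltonianVectorField, h]
  ext i <;> simp

end Smooth

section Latitude

variable {n : ℕ} {m φ : Fin n → ℝ}

theorem latitudeForm_add_smul (w v : Fin n → ℝ) (s : ℝ) :
    latitudeForm m φ (w + s • v) (w + s • v) = latitudeForm m φ w w +
      2 * s * latitudeForm m φ w v + s ^ 2 * latitudeForm m φ v v := by
  have hsymm : latitudeForm m φ v w = latitudeForm m φ w v := by
    have e1 : ∑ i, ∑ j, coupling m φ i j * (v i * w j) =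
        ∑ i, ∑ j, coupling m φ i j * (w i * v j) := by
      rw [Finset.sum_comm]
      refine Finset.sum_congr rfl fun i _ => Finset.sum_congr rfl fun j _ => ?_
      rw [coupling_comm, mul_comm (v j)]
    simp only [latitudeForm, mul_sub, Finset.sum_sub_distrib, e1]
    congr 1
    exact Finset.sum_congr rfl fun i _ => Finset.sum_congr rfl fun j _ => by ring
  have h : latitudeForm m φ (w + s • v) (w + s • v) = latitudeForm m φ w w +
      s * (latitudeForm m φ v w + latitudeForm m φ w v) + s ^ 2 * latitudeForm m φ v v := by
    simp only [latitudeForm, Finset.mul_sum, ← Finset.sum_add_distrib]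
    refine Finset.sum_congr rfl fun i _ => Finset.sum_congr rfl fun j _ => ?_
    simp only [Pi.add_apply, Pi.smul_apply, smul_eq_mul]
    ring
  rw [h, hsymm]
  ring

/-- The largest eigenvalue `τ` of the Hessian of `U` in the latitudes, relative to the form
`∑ m_i w_i²`, and an eigenvector `w`. -/
theorem exists_max_eigenvalue [NeZero n] (hm : ∀ i, 0 < m i) :
    ∃ τ : ℝ, ∃ w : Fin n → ℝ, w ≠ 0 ∧
      (∀ v, latitudeForm m φ v v ≤ τ * ∑ i, m i * v i ^ 2) ∧
      ∀ v, latitudeForm m φ w v = τ * ∑ i, m i * w i * v i := by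
  have hTpos : ∀ v : Fin n → ℝ, v ≠ 0 → 0 < ∑ i, m i * v i ^ 2 := by
    intro v hv
    obtain ⟨i, hi⟩ := Function.ne_iff.1 hv
    exact Finset.sum_pos' (fun j _ => mul_nonneg (hm j).le (sq_nonneg _))
      ⟨i, mem_univ i, mul_pos (hm i) (sq_pos_of_ne_zero hi)⟩
  have hone : (1 : Fin n → ℝ) ≠ 0 := one_ne_zero
  have hne : (Metric.sphere (0 : Fin n → ℝ) 1).Nonempty := ⟨1, by simp⟩
  have hBc : Continuous fun v => latitudeForm m φ v v := by
    unfold latitudeForm; fun_prop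
  obtain ⟨w, hw, hmax⟩ := (isCompact_sphere (0 : Fin n → ℝ) 1).exists_isMaxOn hne
    (f := fun v => latitudeForm m φ v v / ∑ i, m i * v i ^ 2) (by
      refine hBc.continuousOn.div (by fun_prop) fun v hv => (hTpos v ?_).ne'
      rintro rfl
      simp at hv)
  have hw0 : w ≠ 0 := by rintro rfl; simp at hw
  set τ := latitudeForm m φ w w / ∑ i, m i * w i ^ 2 with hτ
  have hle : ∀ v, latitudeForm m φ v v ≤ τ * ∑ i, m i * v i ^ 2 := by
    intro v
    by_cases hv : v = 0
    · simp [hv, latitudeForm]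
    have hv' : ‖v‖ ≠ 0 := norm_ne_zero_iff.2 hv
    have h1 := isMaxOn_iff.1 hmax (‖v‖⁻¹ • v) (by simp [norm_smul, inv_mul_cancel₀ hv'])
    have h2 : latitudeForm m φ (‖v‖⁻¹ • v) (‖v‖⁻¹ • v) / ∑ i, m i * (‖v‖⁻¹ • v) i ^ 2 =
        latitudeForm m φ v v / ∑ i, m i * v i ^ 2 := by
      have e1 : latitudeForm m φ (‖v‖⁻¹ • v) (‖v‖⁻¹ • v) = ‖v‖⁻¹ ^ 2 * latitudeForm m φ v v := by
        simpa [latitudeForm] using latitudeForm_add_smul (m := m) (φ := φ) 0 v ‖v‖⁻¹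
      have e2 : ∑ i, m i * (‖v‖⁻¹ • v) i ^ 2 = ‖v‖⁻¹ ^ 2 * ∑ i, m i * v i ^ 2 := by
        rw [Finset.mul_sum]
        refine Finset.sum_congr rfl fun i _ => ?_
        simp only [Pi.smul_apply, smul_eq_mul]; ring
      rw [e1, e2, mul_div_mul_left _ _ (pow_ne_zero 2 (inv_ne_zero hv'))]
    rw [h2] at h1
    exact (div_le_iff₀ (hTpos v hv)).1 h1
  refine ⟨τ, w, hw0, hle, fun v => ?_⟩
  have hww : latitudeForm m φ w w = τ * ∑ i, m i * w i ^ 2 :=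
    (div_mul_cancel₀ _ (hTpos w hw0).ne').symm
  -- the nonnegative form `τ T - B` vanishes at `w`, so that `w` lies in its kernel
  have hquad : ∀ s : ℝ, 0 ≤ (τ * ∑ i, m i * v i ^ 2 - latitudeForm m φ v v) * (s * s) +
      (2 * (τ * ∑ i, m i * w i * v i - latitudeForm m φ w v)) * s + 0 := by
    intro s
    have h1 := hle (w + s • v)
    have h2 : ∑ i, m i * (w + s • v) i ^ 2 = ∑ i, m i * w i ^ 2 +
        2 * s * ∑ i, m i * w i * v i + s ^ 2 * ∑ i, m i * v i ^ 2 := by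
      simp only [Finset.mul_sum, ← Finset.sum_add_distrib]
      refine Finset.sum_congr rfl fun i _ => ?_
      simp only [Pi.add_apply, Pi.smul_apply, smul_eq_mul]; ring
    rw [latitudeForm_add_smul, h2] at h1
    linarith
  have hd := discrim_le_zero hquad
  rw [discrim, mul_zero, sub_zero] at hd
  have := pow_eq_zero_iff (two_ne_zero) |>.1 (le_antisymm hd (sq_nonneg _))
  linarith

/-- Moving all bodies off the equator by the same latitude increases `U` to second order, as it
shortens all distances; so the largest eigenvalue is positive. -/
theorem latitudeForm_one_pos (hm : ∀ i, 0 < m i) (hφ : ∀ i j, i ≠ j → sin (φ j - φ i) ≠ 0)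
    {i j : Fin n} (hij : i ≠ j) : 0 < latitudeForm m φ 1 1 := by
  have hnn : ∀ i j, 0 ≤ coupling m φ i j * (1 - cos (φ j - φ i)) := fun i j =>
    mul_nonneg (div_nonneg (mul_pos (hm i) (hm j)).le (by positivity))
      (sub_nonneg.2 (cos_le_one _))
  simp only [latitudeForm, Pi.one_apply, mul_one]
  refine Finset.sum_pos' (fun i _ => Finset.sum_nonneg fun j _ => hnn i j) ⟨i, mem_univ i,
    Finset.sum_pos' (fun j _ => hnn i j) ⟨j, mem_univ j, mul_pos ?_ ?_⟩⟩
  · exact div_pos (mul_pos (hm i) (hm j)) (pow_pos (abs_pos.2 (hφ i j hij)) 3)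
  · rw [sub_pos]
    refine lt_of_le_of_ne (cos_le_one _) fun h => hφ i j hij ?_
    exact (sin_eq_zero_iff_cos_eq).2 (Or.inl h)

end Latitude

section Stability

variable {k : ℕ} {m φ : Fin (k + 1) → ℝ}

/-- Above the largest eigenvalue `τ` the centrifugal term `α² ∑ m_i w_i²` dominates the attraction
in the latitudes. -/
theorem hessianForm_pos (hm : ∀ i, 0 < m i)
    (hlong : ∀ x : Fin (k + 1) → ℝ, (∃ i j, x i ≠ x j) → 0 < longitudeForm m φ x)
    {τ α : ℝ} (hτ : ∀ v, latitudeForm m φ v v ≤ τ * ∑ i, m i * v i ^ 2) (hα : τ < α ^ 2)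
    {u : ReducedPhase k} (hu : u ≠ 0) : 0 < hessianForm m φ α u := by
  have hL0 : 0 ≤ longitudeForm m φ (liftLongitude m u) := by
    by_cases h : ∃ i j, liftLongitude m u i ≠ liftLongitude m u j
    · exact (hlong _ h).le
    · push Not at h
      simp only [longitudeForm, h _ 0]
      simp
  have hK0 : ∀ i ∈ univ, 0 ≤ liftMomentum m 0 u i ^ 2 / m i + u.2 (Sum.inr i) ^ 2 / m i :=
    fun i _ => add_nonneg (div_nonneg (sq_nonneg _) (hm i).le) (div_nonneg (sq_nonneg _) (hm i).le)
  have hW := hτ (fun i => u.1 (Sum.inr i))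
  have hT0 : ∀ i ∈ univ, 0 ≤ m i * u.1 (Sum.inr i) ^ 2 :=
    fun i _ => mul_nonneg (hm i).le (sq_nonneg _)
  have hWT : 0 ≤ (α ^ 2 - τ) * ∑ i, m i * u.1 (Sum.inr i) ^ 2 :=
    mul_nonneg (by linarith) (Finset.sum_nonneg hT0)
  have hKs := Finset.sum_nonneg hK0
  have hnn : 0 ≤ hessianForm m φ α u := by
    unfold hessianForm; linarith
  refine lt_of_le_of_ne hnn fun h0 => hu ?_
  unfold hessianForm at h0
  have hK := (Finset.sum_eq_zero_iff_of_nonneg hK0).1 (by linarith)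
  have hT : (α ^ 2 - τ) * ∑ i, m i * u.1 (Sum.inr i) ^ 2 = 0 := by linarith
  have hT' := (Finset.sum_eq_zero_iff_of_nonneg hT0).1
    ((mul_eq_zero.1 hT).resolve_left (by linarith))
  have hL : longitudeForm m φ (liftLongitude m u) = 0 := by linarith
  have hsq : ∀ i, liftMomentum m 0 u i = 0 ∧ u.2 (Sum.inr i) = 0 := by
    intro i
    have h1 := hK i (mem_univ i)
    have h2 := div_nonneg (sq_nonneg (liftMomentum m 0 u i)) (hm i).le
    have h3 := div_nonneg (sq_nonneg (u.2 (Sum.inr i))) (hm i).le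
    have h4 : liftMomentum m 0 u i ^ 2 / m i = 0 := by linarith
    have h5 : u.2 (Sum.inr i) ^ 2 / m i = 0 := by linarith
    have hmi := (hm i).ne'
    constructor
    · simpa [hmi] using h4
    · simpa [hmi] using h5
  have hw : ∀ i, u.1 (Sum.inr i) = 0 := by
    intro i
    simpa [(hm i).ne'] using hT' i (mem_univ i)
  have hx := liftLongitude_eq_zero_of_const hm (u := u) (by
    by_contra! hcon
    exact (hlong _ hcon).ne' hL)
  have hy := eq_zero_of_liftMomentum_eq_zero hm (u := u) (funext fun i => (hsq i).1)
  ext i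
  · rcases i with i | i
    · exact hx i
    · exact hw i
  · rcases i with i | i
    · exact hy i
    · exact (hsq i).2

/-- Below the eigenvalue `τ`, with eigenvector `w`, the linearized equations in the latitudes and
their momenta have the solution `exp (μ t) (w, m μ w)` with `μ² = τ - α²`. -/
theorem linearlyUnstable_reducedVectorField (hm : ∀ i, 0 < m i)
    (hφ : ∀ i j, i ≠ j → sin (φ j - φ i) ≠ 0)
    (heq : ∀ i, ∑ j, coupling m φ i j * sin (φ j - φ i) = 0) {τ α : ℝ} {w : Fin (k + 1) → ℝ}
    (hw : w ≠ 0) (hτ : ∀ v, latitudeForm m φ w v = τ * ∑ i, m i * w i * v i) (hα : α ^ 2 < τ) :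
    LinearlyUnstable (reducedVectorField m (angularMomentum (rotationMomenta m α)))
      (reducedEquilibrium m φ α) := by
  have hH := contDiffAt_reducedHamiltonian hm hφ (angularMomentum (rotationMomenta m α)) α
  have hhess := (fderiv_reducedHamiltonian hm hφ heq α).2
  set H := reducedHamiltonian m (angularMomentum (rotationMomenta m α)) with hHdef
  set Y := reducedEquilibrium m φ α with hY
  obtain ⟨μ, hμ, hμτ⟩ : ∃ μ, 0 < μ ∧ μ ^ 2 = τ - α ^ 2 :=
    ⟨√(τ - α ^ 2), sqrt_pos.2 (by linarith), sq_sqrt (by linarith)⟩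
  set v : ReducedPhase k := (Sum.elim 0 w, Sum.elim 0 fun i => m i * μ * w i) with hv
  have hLv : liftLongitude m v = 0 := by
    have : (Fin.snoc (α := fun _ => ℝ) (fun i => v.1 (Sum.inl i)) 0 : Fin (k + 1) → ℝ) = 0 := by
      funext r
      induction r using Fin.lastCases with
      | last => simp
      | cast i => simp [hv]
    rw [liftLongitude, this, Matrix.mulVec_zero]
  have hMv : liftMomentum m 0 v = 0 := by
    have : (Fin.snoc (α := fun _ => ℝ) (fun i => v.2 (Sum.inl i)) 0 : Fin (k + 1) → ℝ) = 0 := by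
      funext r
      induction r using Fin.lastCases with
      | last => simp
      | cast i => simp [hv]
    rw [liftMomentum, this, Matrix.mulVec_zero]
  have hsymm : ∀ e, fderiv ℝ (fderiv ℝ H) Y v e = fderiv ℝ (fderiv ℝ H) Y e v := fun e =>
    (hH.isSymmSndFDerivAt (by simp)).eq v e
  -- the Hessian paired with `v`, by polarization
  have hpol : ∀ e : ReducedPhase k, fderiv ℝ (fderiv ℝ H) Y v e =
      μ * ∑ i, w i * e.2 (Sum.inr i) - μ ^ 2 * ∑ i, m i * w i * e.1 (Sum.inr i) := by
    intro e
    have h1 := hhess (e + (1 : ℝ) • v)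
    have hL := liftLongitude_add_smul (m := m) e v 1
    have hM := liftMomentum_add_smul (m := m) e v 0 0 1
    rw [hLv, smul_zero, add_zero] at hL
    rw [hMv, smul_zero, add_zero, mul_zero, add_zero] at hM
    have hlat := latitudeForm_add_smul (m := m) (φ := φ) w (fun i => e.1 (Sum.inr i)) 1
    have h2 : hessianForm m φ α (e + (1 : ℝ) • v) = hessianForm m φ α e + hessianForm m φ α v +
        2 * (μ * ∑ i, w i * e.2 (Sum.inr i) - μ ^ 2 * ∑ i, m i * w i * e.1 (Sum.inr i)) := by
      have e1 : (fun i => (e + (1 : ℝ) • v).1 (Sum.inr i)) =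
          w + (1 : ℝ) • fun i => e.1 (Sum.inr i) := by
        funext i; simp [hv, add_comm]
      have e2 : ∀ i, (e + (1 : ℝ) • v).1 (Sum.inr i) = e.1 (Sum.inr i) + w i := by
        intro i; simp [hv]
      have e3 : ∀ i, (e + (1 : ℝ) • v).2 (Sum.inr i) = e.2 (Sum.inr i) + m i * μ * w i := by
        intro i; simp [hv]
      have e5 : ∀ i, v.2 (Sum.inr i) = m i * μ * w i := fun i => rfl
      have e6 : ∀ i, v.1 (Sum.inr i) = w i := fun i => rfl
      have s1 : ∑ i, (liftMomentum m 0 e i ^ 2 / m i +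
            (e.2 (Sum.inr i) + m i * μ * w i) ^ 2 / m i) =
          ∑ i, (liftMomentum m 0 e i ^ 2 / m i + e.2 (Sum.inr i) ^ 2 / m i) +
          ∑ i, (m i * μ * w i) ^ 2 / m i + 2 * (μ * ∑ i, w i * e.2 (Sum.inr i)) := by
        simp only [Finset.mul_sum, ← Finset.sum_add_distrib]
        refine Finset.sum_congr rfl fun i _ => ?_
        have := (hm i).ne'
        field_simp
        ring
      have s2 : ∑ i, m i * (e.1 (Sum.inr i) + w i) ^ 2 = ∑ i, m i * e.1 (Sum.inr i) ^ 2 +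
          ∑ i, m i * w i ^ 2 + 2 * ∑ i, m i * w i * e.1 (Sum.inr i) := by
        simp only [Finset.mul_sum, ← Finset.sum_add_distrib]
        exact Finset.sum_congr rfl fun i _ => by ring
      have s3 : longitudeForm m φ 0 = 0 := by simp [longitudeForm]
      unfold hessianForm
      rw [hL, hM, e1, hlat, hLv, hMv, s3]
      simp only [e2, e3, e5, e6, s1, s2, hτ, hμτ]
      simp
      ring
    have h3 : fderiv ℝ (fderiv ℝ H) Y (e + (1 : ℝ) • v) (e + (1 : ℝ) • v) =
        fderiv ℝ (fderiv ℝ H) Y e e + fderiv ℝ (fderiv ℝ H) Y v v +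
          2 * fderiv ℝ (fderiv ℝ H) Y v e := by
      rw [one_smul, (fderiv ℝ (fderiv ℝ H) Y).map_add, add_apply, map_add, map_add, ← hsymm e]
      ring
    rw [h3, h2, hhess, hhess] at h1
    linarith
  refine linearlyUnstable_of_apply_eq_smul (v := v) (μ := μ)
    ((contDiffAt_hamiltonianVectorField hH).differentiableAt (by simp)) hμ ?_ ?_
  · intro h0
    refine hw (funext fun i => ?_)
    exact congrFun (congrArg Prod.fst h0) (Sum.inr i)
  · rw [reducedVectorField, fderiv_hamiltonianVectorField_apply hH]
    ext i
    · change fderiv ℝ (fderiv ℝ H) Y v _ = μ * v.1 i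
      rw [hpol]
      rcases i with i | i
      · simp [hv]
      · simp [hv, Pi.single_apply, Sum.inr.injEq]
    · change -fderiv ℝ (fderiv ℝ H) Y v _ = μ * v.2 i
      rw [hpol]
      rcases i with i | i
      · simp [hv]
      · simp [hv, Pi.single_apply, Sum.inr.injEq]
        ring

end Stability

end CurvedNBody

theorem corollary11 (p : ℕ) (hp : 1 ≤ p) :
    ∃ ε : ℝ, 0 < ε ∧ ∀ m φ : Fin (2 * p + 1) → ℝ, (∀ i, 0 < m i) →
      (∀ i, dist (CurvedNBody.equatorPoint (φ i))
        (CurvedNBody.regularPolygon (2 * p + 1) i) < ε) →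
      CurvedNBody.IsEquilibriumConfiguration m (fun i => CurvedNBody.equatorPoint (φ i)) →
      (∀ α : ℝ, CurvedNBody.IsEquilibriumPoint
        (CurvedNBody.reducedVectorField m
          (CurvedNBody.angularMomentum (CurvedNBody.rotationMomenta m α)))
        (CurvedNBody.reducedEquilibrium m φ α)) ∧
      ∃ τ : ℝ, 0 < τ ∧ ∀ α : ℝ,
        (α ^ 2 < τ → CurvedNBody.LinearlyUnstable
          (CurvedNBody.reducedVectorField m
            (CurvedNBody.angularMomentum (CurvedNBody.rotationMomenta m α)))
          (CurvedNBody.reducedEquilibrium m φ α)) ∧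
        (τ < α ^ 2 → CurvedNBody.LyapunovStable
          (CurvedNBody.reducedVectorField m
            (CurvedNBody.angularMomentum (CurvedNBody.rotationMomenta m α)))
          (CurvedNBody.reducedEquilibrium m φ α)) := by
  open CurvedNBody in
  obtain ⟨ε, hε, hpos⟩ := exists_hessian_pos_near_regular hp
  refine ⟨ε, hε, fun m φ hm hdist hq => ?_⟩
  have hφ : ∀ i j, i ≠ j → Real.sin (φ j - φ i) ≠ 0 := fun i j hij => hq.sin_sub_ne_zero hij
  have heq := hq.sum_coupling_mul_sin
  have hforce : ∀ i, ∑ j, Real.sin (φ j - φ i) / |Real.sin (φ j - φ i)| ^ 3 * m j = 0 := by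
    intro i
    have h1 : m i * ∑ j, Real.sin (φ j - φ i) / |Real.sin (φ j - φ i)| ^ 3 * m j = 0 := by
      rw [← heq i, Finset.mul_sum]
      exact Finset.sum_congr rfl fun j _ => by rw [coupling]; ring
    exact (mul_eq_zero.1 h1).resolve_left (hm i).ne'
  have hlong : ∀ x : Fin (2 * p + 1) → ℝ, (∃ i j, x i ≠ x j) → 0 < longitudeForm m φ x := by
    intro x hx
    refine (hpos m φ hm hdist hforce x hx).trans_eq ?_
    exact Finset.sum_congr rfl fun i _ => Finset.sum_congr rfl fun j _ => by
      rw [coupling]; ring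
  refine ⟨reducedEquilibrium_isEquilibriumPoint hm hφ heq, ?_⟩
  obtain ⟨τ, w, hw, hmax, hτ⟩ := exists_max_eigenvalue (φ := φ) hm
  refine ⟨τ, ?_, fun α => ⟨linearlyUnstable_reducedVectorField hm hφ heq hw hτ, fun hα => ?_⟩⟩
  · have h01 : (0 : Fin (2 * p + 1)) ≠ ⟨1, by omega⟩ := by simp [Fin.ext_iff]
    have h1 := (latitudeForm_one_pos hm hφ h01).trans_le (hmax 1)
    exact pos_of_mul_pos_left h1 (Finset.sum_nonneg fun i _ =>
      mul_nonneg (hm i).le (sq_nonneg _))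
  · refine lyapunovStable_hamiltonianVectorField (contDiffAt_reducedHamiltonian hm hφ _ α)
      (fderiv_reducedHamiltonian hm hφ heq α).1 fun u hu => ?_
    rw [(fderiv_reducedHamiltonian hm hφ heq α).2]
    exact hessianForm_pos hm hlong hmax hα hu
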